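/- For an even integer $n \ge 16$, let $W_{4,n}$ be the 4-regular Knödel graph: its vertices are the pairs $(i,j)$ with $i\in\{1,2\}$ and $0\le j\le n/2-1$, and its edges join each $(1,j)$ to the vertices $(2,(j+2^k-1) \bmod (n/2))$ for $k=0,1,2,3$. The domination number $\gamma(G)$ of a finite graph $G$ is the minimum cardinality of a set $D$ of vertices such that every vertex not in $D$ is adjacent to a vertex of $D$, and $G$ is called $\gamma$-critical if $\gamma(G-u)<\gamma(G)$ for every vertex $u$ of $G$. **Theorem.** For every even integer $n\ge 16$, the graph $W_{4,n}$ is $\gamma$-critical if and only if one of the following holds: (i) $n=26$; (ii) $n\ge 22$ and $n\equiv 2 \pmod{10}$; (iii) $n\ge 38$ and $n\equiv 8 \pmod{10}$. -/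

import Mathlib

/-- A finite set `D` of vertices is dominating if every vertex outside `D` has a neighbour in `D`. -/
def IsDominatingSet {V : Type*} (G : SimpleGraph V) (D : Finset V) : Prop :=
  ∀ u, u ∉ D → ∃ v ∈ D, G.Adj u v

/-- The domination number: the least cardinality of a dominating set. It is meant for graphs on
finitely many vertices, where the set of all vertices is dominating, so that the infimum is a
minimum. -/
noncomputable def dominationNumber {V : Type*} (G : SimpleGraph V) : ℕ :=
  sInf {k : ℕ | ∃ D : Finset V, IsDominatingSet G D ∧ D.card = k}

/-- The graph `G - u`, obtained by deleting the vertex `u`. -/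
def deleteVertex {V : Type*} (G : SimpleGraph V) (u : V) : SimpleGraph {w : V // w ≠ u} :=
  G.induce {w : V | w ≠ u}

/-- A graph is domination vertex critical if deleting any vertex decreases the domination
number. -/
def IsDominationCritical {V : Type*} (G : SimpleGraph V) : Prop :=
  ∀ u : V, dominationNumber (deleteVertex G u) < dominationNumber G

/-- Adjacency in the Knödel graph. The vertex `(1, j)` is `Sum.inl j` and `(2, j)` is `Sum.inr j`,
with `j` an integer modulo `n / 2`. There is an edge between `(1, i)` and `(2, i + 2 ^ k - 1)` for
each `k = 0, …, Δ - 1`, and there are no other edges. -/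
def KnodelAdj (Δ n : ℕ) : ZMod (n / 2) ⊕ ZMod (n / 2) → ZMod (n / 2) ⊕ ZMod (n / 2) → Prop
  | Sum.inl i, Sum.inr j => ∃ k < Δ, j = i + (2 ^ k - 1)
  | Sum.inr j, Sum.inl i => ∃ k < Δ, j = i + (2 ^ k - 1)
  | Sum.inl _, Sum.inl _ => False
  | Sum.inr _, Sum.inr _ => False

/-- The Knödel graph `W_{Δ,n}`, for even `n ≥ 2` and `1 ≤ Δ ≤ log₂ n`. -/
def knodelGraph (Δ n : ℕ) : SimpleGraph (ZMod (n / 2) ⊕ ZMod (n / 2)) where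
  Adj := KnodelAdj Δ n
  symm := ⟨by rintro (i | i) (j | j) h <;> exact h⟩
  loopless := ⟨by rintro (i | i) h <;> exact h⟩

/-! Write m = n/2, and let a set consist of left vertices A and right vertices B. The right vertices
reached from A form `spread A`, the union of the translates of {0, 1, 3, 7}. Dominating the right
side needs |B| + 4|A| ≥ m, and dominating the left side needs |A| + 4|B| ≥ m. Modulo 5 the set {0,
1, 3, 7} is {0, 1, 3, 2}, so steps of five are efficient, and all depends on m modulo 5.
Translations and x ↦ -x with the sides exchanged make the graph vertex transitive, so one deleted
vertex decides criticality.

Let m = 5q + r. The constructions give a cover of size 2q, 2q + 2, 2q + 3 for r = 0, 2, 3, and a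
cover of all but one vertex of size 2q + 1, 2q + 3 for r = 1, 4. What remains is to show that for r
= 0, 2, 3 deleting a vertex saves nothing, and that for r = 1, 4 the whole graph needs one vertex
more. For r = 0 counting is enough. In the other cases counting leaves few sizes for A and B, and
three arguments exclude them.

If |A| = q, the translates must be disjoint. Then the gaps in A are 5 or at least 8, which is
impossible for r = 1, 2 and makes A a progression for r = 3 (`NoOverlap.exists_progression`).

If |A| = q + 1 with r = 3, 4, then 5|A| > m and translates must overlap. Overlaps and elements of B
inside `spread A` are paid from a common budget of two. By the cycle lemma the walk with steps +4 on
A and -1 off A can be started so that it stays positive. Positivity bounds the gaps in A from above,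
while a bounded number of overlaps forces almost all of them to be 5. Hence A is known near its
short gaps, where some left vertices outside A have all their neighbours in `spread A`. Dominating
these takes more elements of B inside `spread A` than the budget allows.

The small cases m = 8, 9, 13, 14, 18 use explicit covers, and m = 13 also a finite check. -/

/-! ### Positive walks: gaps, overlaps and forced steps of five. -/

section Walk

/-- The integers dominated from the left side by the left vertices in `M`. -/
def intSpread (M : Finset ℤ) : Finset ℤ :=
  M.biUnion fun x => {x, x + 1, x + 3, x + 7}

/-- `α` is the indicator of an `m`-periodic set of integers, `f` counts its elements with weight
`4` against `-1` for the others, all partial sums over an initial part of the period are positive,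
and the spread of the set loses at most `ℓ` elements to overlaps. -/
structure PositiveWalk (m : ℤ) (ℓ : ℕ) (α : ℤ → Prop) (f : ℤ → ℤ) : Prop where
  periodic : ∀ x, α (x + m) ↔ α x
  zero : f 0 = 0
  up : ∀ x, 0 ≤ x → α x → f (x + 1) = f x + 4
  down : ∀ x, 0 ≤ x → ¬ α x → f (x + 1) = f x - 1
  pos : ∀ j, 1 ≤ j → j ≤ m → 1 ≤ f j
  loss : ∀ M : Finset ℤ, (∀ x ∈ M, α x) → (∀ x ∈ M, ∀ y ∈ M, x - y < m) →
    4 * M.card ≤ (intSpread M).card + ℓ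

/-- `x` is outside the set while all its right neighbours are dominated from the left. -/
def Unreached (α : ℤ → Prop) (x : ℤ) : Prop :=
  ¬ α x ∧ ∀ s ∈ ({0, 1, 3, 7} : Finset ℤ), ∃ a, α a ∧ ∃ r ∈ ({0, 1, 3, 7} : Finset ℤ), x + s = a + r

theorem Unreached.of_eq {α : ℤ → Prop} {x a b c d : ℤ} (hx : ¬ α x)
    (ha : α a) (hb : α b) (hc : α c) (hd : α d)
    (ha' : x = a ∨ x = a + 1 ∨ x = a + 3 ∨ x = a + 7 := by omega)
    (hb' : x + 1 = b ∨ x + 1 = b + 1 ∨ x + 1 = b + 3 ∨ x + 1 = b + 7 := by omega)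
    (hc' : x + 3 = c ∨ x + 3 = c + 1 ∨ x + 3 = c + 3 ∨ x + 3 = c + 7 := by omega)
    (hd' : x + 7 = d ∨ x + 7 = d + 1 ∨ x + 7 = d + 3 ∨ x + 7 = d + 7 := by omega) : Unreached α x := by
  refine ⟨hx, ?_⟩
  simp only [Finset.mem_insert, Finset.mem_singleton, forall_eq_or_imp, forall_eq, exists_eq_or_imp,
    exists_eq_left, add_zero]
  exact ⟨⟨a, ha, ha'⟩, ⟨b, hb, hb'⟩, ⟨c, hc, hc'⟩, ⟨d, hd, hd'⟩⟩

namespace PositiveWalk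

variable {m : ℤ} {ℓ : ℕ} {α : ℤ → Prop} {f : ℤ → ℤ}

theorem mem_zero (W : PositiveWalk m ℓ α f) (hm : 1 ≤ m) : α 0 := by
  by_contra h
  have h1 := W.down 0 le_rfl h
  have h2 := W.pos 1 le_rfl hm
  rw [W.zero] at h1
  norm_num at h1
  omega

/-- The walk rises to v + 4 just after b and then falls by one per step, so it would reach 0 unless
the next element comes within v + 4. The bound on b + v + 5 keeps the argument inside the period,
where positivity is known. -/
theorem next (W : PositiveWalk m ℓ α f) {b v : ℤ} (hα : α b) (hf : f b = v)
    (hb : 0 ≤ b := by norm_num) (hm : b + v + 5 ≤ m := by omega) (hv : -4 ≤ v := by norm_num) :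
    ∃ g, 1 ≤ g ∧ g ≤ v + 4 ∧ α (b + g) ∧ f (b + g) = v + 5 - g ∧
      ∀ x, b < x → x < b + g → ¬ α x := by
  classical
  have key : ∀ k : ℕ, (∀ x, b < x → x < b + 1 + k → ¬ α x) → f (b + 1 + k) = v + 4 - k := by
    intro k
    induction k with
    | zero => intro _; simpa [hf] using W.up b hb hα
    | succ k ih =>
      intro h
      have h1 := ih fun x hx hx' => h x hx (by push_cast; omega)
      have h2 := W.down (b + 1 + k) (by omega) (h _ (by omega) (by push_cast; omega))
      push_cast
      rw [← add_assoc, h2, h1]; ring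
  have hex : ∃ k : ℕ, α (b + 1 + k) := by
    by_contra hno
    push Not at hno
    have hk := key (v + 4).toNat fun x hx hx' => by
      have := hno (x - b - 1).toNat
      rwa [show b + 1 + ((x - b - 1).toNat : ℤ) = x by omega] at this
    have := W.pos (b + 1 + (v + 4).toNat) (by omega) (by omega)
    omega
  have hmin : ∀ x, b < x → x < b + 1 + (Nat.find hex : ℤ) → ¬ α x := by
    intro x hx hx' hαx
    have := Nat.find_min hex (m := (x - b - 1).toNat) (by omega)
    rw [show b + 1 + ((x - b - 1).toNat : ℤ) = x by omega] at this
    exact this hαx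
  have hfk := key (Nat.find hex) hmin
  have hle : (Nat.find hex : ℤ) ≤ v + 3 := by
    by_contra hlt
    push Not at hlt
    have hk := key (v + 4).toNat fun x hx hx' => hmin x hx (by omega)
    have := W.pos (b + 1 + (v + 4).toNat) (by omega) (by omega)
    omega
  refine ⟨Nat.find hex + 1, by omega, by omega, ?_, ?_, ?_⟩
  · have := Nat.find_spec hex
    rwa [show b + ((Nat.find hex : ℤ) + 1) = b + 1 + Nat.find hex by ring]
  · rw [show b + ((Nat.find hex : ℤ) + 1) = b + 1 + Nat.find hex by ring, hfk]; ring
  · intro x hx hx'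
    exact hmin x hx (by omega)

/-- The numeral K stands in for the variable period m, so that for explicit M both the span and the
loss are settled by `decide`. -/
theorem not_loss (W : PositiveWalk m ℓ α f) (M : Finset ℤ) (K : ℤ) (hK : K ≤ m)
    (hM : ∀ x ∈ M, α x) (hspan : ∀ x ∈ M, ∀ y ∈ M, x - y < K := by decide)
    (hloss : (intSpread M).card + ℓ < 4 * M.card := by decide) : False := by
  have := W.loss M hM fun x hx y hy => (hspan x hx y hy).trans_le hK
  omega

theorem card_intSpread_insert_le (M : Finset ℤ) (y : ℤ) :
    (intSpread (insert y M)).card ≤ (intSpread M).card + 4 := by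
  rw [intSpread, Finset.biUnion_insert, Finset.union_comm]
  exact (Finset.card_union_le _ _).trans (Nat.add_le_add_left Finset.card_le_four _)

/-- An element at an overlapping distance from an element of `M` adds at most three elements to the
spread of `M`. -/
theorem card_intSpread_insert_le_of_mem (M : Finset ℤ) {x y d : ℤ} (hx : x ∈ M)
    (hd : d ∈ ({1, 2, 3, 4, 6, 7} : Finset ℤ)) (hxy : y = x + d ∨ x = y + d) :
    (intSpread (insert y M)).card ≤ (intSpread M).card + 3 := by
  have hmem : ∃ s ∈ ({y, y + 1, y + 3, y + 7} : Finset ℤ), s ∈ intSpread M := by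
    have hsub : ∀ s ∈ ({x, x + 1, x + 3, x + 7} : Finset ℤ), s ∈ intSpread M := fun s hs =>
      Finset.mem_biUnion.2 ⟨x, hx, hs⟩
    simp only [Finset.mem_insert, Finset.mem_singleton] at hd hsub ⊢
    have h0 := hsub x (by simp)
    have h1 := hsub (x + 1) (by simp)
    have h3 := hsub (x + 3) (by simp)
    have h7 := hsub (x + 7) (by simp)
    rcases hxy with rfl | rfl
    · rcases hd with rfl | rfl | rfl | rfl | rfl | rfl
      · exact ⟨_, Or.inl rfl, h1⟩
      · exact ⟨_, Or.inr (Or.inl rfl), by simpa [add_assoc] using h3⟩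
      · exact ⟨_, Or.inl rfl, h3⟩
      · exact ⟨_, Or.inr (Or.inr (Or.inl rfl)), by simpa [add_assoc] using h7⟩
      · exact ⟨_, Or.inr (Or.inl rfl), by simpa [add_assoc] using h7⟩
      · exact ⟨_, Or.inl rfl, h7⟩
    · rcases hd with rfl | rfl | rfl | rfl | rfl | rfl
      · exact ⟨_, Or.inr (Or.inl rfl), h0⟩
      · exact ⟨_, Or.inr (Or.inr (Or.inl rfl)), by simpa [add_assoc] using h1⟩
      · exact ⟨_, Or.inr (Or.inr (Or.inl rfl)), h0⟩
      · exact ⟨_, Or.inr (Or.inr (Or.inr rfl)), by simpa [add_assoc] using h3⟩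
      · exact ⟨_, Or.inr (Or.inr (Or.inr rfl)), by simpa [add_assoc] using h1⟩
      · exact ⟨_, Or.inr (Or.inr (Or.inr rfl)), h0⟩
  obtain ⟨s, hs, hsM⟩ := hmem
  have hsub : intSpread (insert y M) ⊆ intSpread M ∪ ({y, y + 1, y + 3, y + 7} : Finset ℤ).erase s := by
    intro z hz
    rw [intSpread, Finset.biUnion_insert, Finset.mem_union] at hz
    rw [Finset.mem_union, Finset.mem_erase]
    rcases hz with hz | hz
    · by_cases hzs : z = s
      · exact Or.inl (hzs ▸ hsM)
      · exact Or.inr ⟨hzs, hz⟩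
    · exact Or.inl hz
  have h4 : ({y, y + 1, y + 3, y + 7} : Finset ℤ).card ≤ 4 := Finset.card_le_four
  have := Finset.card_erase_of_mem hs
  have := (Finset.card_le_card hsub).trans (Finset.card_union_le _ _)
  omega

/-- Once `M` accounts for all overlaps, no overlap other than those inside `M` is possible. -/
theorem not_overlap (W : PositiveWalk m ℓ α f) (M : Finset ℤ) (u : ℤ)
    (hM : ∀ x ∈ M, α x) (hu : ∀ x ∈ M, u ≤ x ∧ x < u + m)
    (hloss : (intSpread M).card + ℓ ≤ 4 * M.card) {p d : ℤ}
    (hd : d ∈ ({1, 2, 3, 4, 6, 7} : Finset ℤ)) (hp : α p) (hpd : α (p + d))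
    (hup : u ≤ p) (hpu : p + d < u + m) (hnot : p ∉ M ∨ p + d ∉ M) : False := by
  have hd0 : 0 < d := by
    simp only [Finset.mem_insert, Finset.mem_singleton] at hd; omega
  have span : ∀ N : Finset ℤ, (∀ x ∈ N, u ≤ x ∧ x < u + m) → ∀ x ∈ N, ∀ y ∈ N, x - y < m := by
    intro N hN x hx y hy
    have := hN x hx; have := hN y hy; omega
  by_cases h1 : p ∈ M
  · have h2 : p + d ∉ M := hnot.resolve_left (not_not.2 h1)
    have hc := card_intSpread_insert_le_of_mem M h1 hd (Or.inl rfl)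
    have hl := W.loss (insert (p + d) M) (by simpa [hpd] using hM)
      (span _ (by simpa using ⟨⟨by omega, hpu⟩, hu⟩))
    rw [Finset.card_insert_of_notMem h2] at hl
    omega
  · by_cases h2 : p + d ∈ M
    · have hc := card_intSpread_insert_le_of_mem M h2 hd (Or.inr rfl)
      have hl := W.loss (insert p M) (by simpa [hp] using hM)
        (span _ (by simpa using ⟨⟨by omega, by omega⟩, hu⟩))
      rw [Finset.card_insert_of_notMem h1] at hl
      omega
    · have hc := card_intSpread_insert_le_of_mem (insert p M) (Finset.mem_insert_self p M) hd
        (Or.inl rfl)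
      have hc' := card_intSpread_insert_le M p
      have hl := W.loss (insert (p + d) (insert p M)) (by simpa [hp, hpd] using hM)
        (span _ (by simpa using ⟨⟨by omega, hpu⟩, ⟨by omega, by omega⟩, hu⟩))
      rw [Finset.card_insert_of_notMem (by simp [h2]; omega), Finset.card_insert_of_notMem h1] at hl
      omega

/-- No overlap is left beyond `b`. -/
def Exhausted (m : ℤ) (α : ℤ → Prop) (b : ℤ) : Prop :=
  ∀ p d, b ≤ p → p + d < m → d ∈ ({1, 2, 3, 4, 6, 7} : Finset ℤ) → α p → ¬ α (p + d)

theorem exhausted (W : PositiveWalk m ℓ α f) (M : Finset ℤ) (b : ℤ)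
    (hM : ∀ x ∈ M, α x) (hb : ∀ x ∈ M, 0 ≤ x ∧ x ≤ b := by decide)
    (hloss : (intSpread M).card + ℓ ≤ 4 * M.card := by decide) (hb0 : 0 ≤ b := by norm_num) : Exhausted m α b := by
  intro p d hp hpd hd hαp hαpd
  have hd0 : 0 < d := by
    simp only [Finset.mem_insert, Finset.mem_singleton] at hd; omega
  refine W.not_overlap M 0 hM (fun x hx => ?_) hloss hd hαp hαpd (by omega) (by omega) (Or.inr ?_)
  · have := hb x hx; omega
  · intro h
    have := hb _ h; omega

/-- An overlapping pair outside `M` accounts for the last missing overlap. -/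
theorem exhausted_pair (W : PositiveWalk m ℓ α f) (M : Finset ℤ) (c d : ℤ)
    (hM : ∀ x ∈ M, α x) (hc : α c) (hcd : α (c + d)) (hb : ∀ x ∈ M, 0 ≤ x ∧ x < c)
    (hc0 : 0 ≤ c) (hloss : (intSpread M).card + ℓ ≤ 4 * M.card + 1 := by decide)
    (hd : d ∈ ({1, 2, 3, 4, 6, 7} : Finset ℤ) := by decide) : Exhausted m α (c + d) := by
  have hd0 : 0 < d := by
    simp only [Finset.mem_insert, Finset.mem_singleton] at hd; omega
  have h1 : c ∉ M := fun h => by have := hb c h; omega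
  have h2 : c + d ∉ insert c M := fun h => by
    rcases Finset.mem_insert.1 h with h | h
    · omega
    · have := hb _ h; omega
  refine W.exhausted (insert (c + d) (insert c M)) (c + d) (by simpa [hc, hcd] using hM) ?_ ?_
    (by omega)
  · intro x hx
    rcases Finset.mem_insert.1 hx with rfl | hx
    · omega
    rcases Finset.mem_insert.1 hx with rfl | hx
    · omega
    have := hb x hx
    omega
  · have h3 := card_intSpread_insert_le_of_mem (insert c M) (Finset.mem_insert_self c M) hd
      (Or.inl rfl)
    have h4 := card_intSpread_insert_le M c
    rw [Finset.card_insert_of_notMem h2, Finset.card_insert_of_notMem h1]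
    omega

theorem Exhausted.mono {b c : ℤ} (h : Exhausted m α b) (hbc : b ≤ c) : Exhausted m α c :=
  fun p d hp => h p d (hbc.trans hp)

/-- Two translates of {0, 1, 3, 7} meet exactly at the distances 1, 2, 3, 4, 6, 7, so 5 is the only
gap below 8 without an overlap. -/
theorem next_of_exhausted (W : PositiveWalk m ℓ α f) {b v : ℤ} (hE : Exhausted m α b)
    (hα : α b) (hf : f b = v) (hb : 0 ≤ b := by norm_num) (hm : b + v + 5 ≤ m := by omega)
    (hv : 0 ≤ v := by norm_num) :
    ∃ g, (g = 5 ∨ 8 ≤ g) ∧ g ≤ v + 4 ∧ α (b + g) ∧ f (b + g) = v + 5 - g ∧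
      ∀ x, b < x → x < b + g → ¬ α x := by
  obtain ⟨g, h1, h2, h3, h4, h5⟩ := W.next hα hf hb hm (by omega)
  refine ⟨g, ?_, h2, h3, h4, h5⟩
  by_contra hg
  refine hE b g le_rfl (by omega) ?_ hα h3
  simp only [Finset.mem_insert, Finset.mem_singleton]
  omega

/-- A weight of at most 3 allows gaps of at most 7, hence only 5, and a gap of 5 preserves the
weight. -/
theorem rest (W : PositiveWalk m ℓ α f) {b v : ℤ} (hE : Exhausted m α b)
    (hα : α b) (hf : f b = v) (j : ℕ) (hb : 0 ≤ b := by norm_num) (hv : 1 ≤ v := by norm_num)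
    (hv' : v ≤ 3 := by norm_num) (hj : b + 5 * j + v ≤ m := by norm_num; omega) : α (b + 5 * j) ∧ f (b + 5 * j) = v := by
  induction j with
  | zero => simpa using ⟨hα, hf⟩
  | succ j ih =>
    push_cast at hj ⊢
    obtain ⟨h1, h2⟩ := ih (by omega)
    obtain ⟨g, hg, hg', h3, h4, -⟩ := W.next_of_exhausted (hE.mono (by omega)) h1 h2 (by omega)
      (by omega) (by omega)
    obtain rfl : g = 5 := by omega
    rw [show b + 5 * ((j : ℤ) + 1) = b + 5 * j + 5 by ring]
    exact ⟨h3, by omega⟩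

/-- The forced progression is followed to the end of the period and read off at the negative
position e, just before the start 0, where it may collide with the first elements. -/
theorem rest_end (W : PositiveWalk m ℓ α f) {b v : ℤ} (hE : Exhausted m α b)
    (hα : α b) (hf : f b = v) (e : ℤ) (hb : 0 ≤ b := by norm_num) (hv : 1 ≤ v := by norm_num)
    (hv' : v ≤ 3 := by norm_num) (he : e + v ≤ 0 := by norm_num) (hbe : b ≤ e + m := by omega)
    (hdvd : 5 ∣ e + m - b := by omega) : α e := by
  obtain ⟨c, hc⟩ := hdvd
  have := (W.rest hE hα hf c.toNat hb hv hv' (by omega)).1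
  rw [show b + 5 * (c.toNat : ℤ) = e + m by omega] at this
  exact (W.periodic e).1 this

theorem not_rest_end (W : PositiveWalk m ℓ α f) (M : Finset ℤ) (e : ℤ) {b v : ℤ} (K : ℤ)
    (hK : K ≤ m) (hM : ∀ x ∈ M, α x) (hα : α b) (hf : f b = v)
    (hb : ∀ x ∈ M, 0 ≤ x ∧ x ≤ b := by decide)
    (hloss : (intSpread M).card + ℓ ≤ 4 * M.card := by decide)
    (hspan : ∀ x ∈ insert e M, ∀ y ∈ insert e M, x - y < K := by decide)
    (hloss' : (intSpread (insert e M)).card + ℓ < 4 * (insert e M).card := by decide)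
    (hb0 : 0 ≤ b := by norm_num) (hv : 1 ≤ v := by norm_num) (hv' : v ≤ 3 := by norm_num)
    (he : e + v ≤ 0 := by norm_num) (hbe : b ≤ e + m := by omega)
    (hdvd : 5 ∣ e + m - b := by omega) : False :=
  W.not_loss _ K hK (by
    simpa using ⟨W.rest_end (W.exhausted M b hM hb hloss hb0) hα hf e hb0 hv hv' he hbe hdvd, hM⟩)
    hspan hloss'

/-- Weight 4 also permits a gap of 8. It lowers the weight to 1 and so is followed by gaps of 5
only; since 8 ≡ 3 modulo 5, the progression then ends at e + 3 in place of e. -/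
theorem rest_end_four (W : PositiveWalk m ℓ α f) {b : ℤ} (hE : Exhausted m α b)
    (hα : α b) (hf : f b = 4) (e : ℤ) (hb : 0 ≤ b := by norm_num) (he : e + 4 ≤ 0 := by norm_num)
    (hbe : b ≤ e + m := by omega) (hdvd : 5 ∣ e + m - b := by omega) : α e ∨ α (e + 3) := by
  by_contra hcon
  push Not at hcon
  obtain ⟨c, hc⟩ := hdvd
  have key : ∀ j : ℕ, (j : ℤ) ≤ c → α (b + 5 * j) ∧ f (b + 5 * j) = 4 := by
    intro j
    induction j with
    | zero => intro _; simpa using ⟨hα, hf⟩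
    | succ j ih =>
      intro hj
      push_cast at hj ⊢
      obtain ⟨h1, h2⟩ := ih (by omega)
      obtain ⟨g, hg, hg', h3, h4, -⟩ := W.next_of_exhausted (hE.mono (by omega)) h1 h2 (by omega)
        (by omega) (by omega)
      rw [show b + 5 * ((j : ℤ) + 1) = b + 5 * j + 5 by ring]
      rcases hg with rfl | hg
      · exact ⟨h3, by omega⟩
      · obtain rfl : g = 8 := by omega
        exact absurd (W.rest_end (hE.mono (by omega)) h3 h4 (e + 3) (by omega) (by norm_num)
          (by norm_num) (by omega) (by omega) ⟨c - j - 1, by omega⟩) hcon.2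
  have := (key c.toNat (by omega)).1
  rw [show b + 5 * (c.toNat : ℤ) = e + m by omega] at this
  exact hcon.1 ((W.periodic e).1 this)

theorem intSpread_map (M : Finset ℤ) (c : ℤ) :
    intSpread (M.map (addRightEmbedding c)) = (intSpread M).map (addRightEmbedding c) := by
  ext z
  simp only [intSpread, Finset.mem_biUnion, Finset.mem_map, Finset.mem_insert, Finset.mem_singleton,
    addRightEmbedding_apply]
  constructor
  · rintro ⟨_, ⟨x, hx, rfl⟩, hz⟩
    exact ⟨z - c, ⟨x, hx, by omega⟩, by omega⟩
  · rintro ⟨y, ⟨x, hx, hy⟩, rfl⟩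
    exact ⟨x + c, ⟨x, hx, rfl⟩, by omega⟩

/-- `not_overlap` for the translate by `c` of an explicit set. -/
theorem not_overlap_translate (W : PositiveWalk m ℓ α f) (N : Finset ℤ) (c u p d : ℤ)
    (hN : ∀ x ∈ N, α (x + c)) (hp : α p) (hpd : α (p + d))
    (hu : ∀ x ∈ N, u ≤ x + c ∧ x + c < u + m) (hup : u ≤ p) (hpu : p + d < u + m)
    (hnot : p - c ∉ N ∨ p + d - c ∉ N)
    (hloss : (intSpread N).card + ℓ ≤ 4 * N.card := by decide)
    (hd : d ∈ ({1, 2, 3, 4, 6, 7} : Finset ℤ) := by decide) : False := by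
  refine W.not_overlap (N.map (addRightEmbedding c)) u ?_ ?_ ?_ hd hp hpd hup hpu ?_
  · simpa using hN
  · simpa using hu
  · rwa [intSpread_map, Finset.card_map, Finset.card_map]
  · have key : ∀ z, z - c ∉ N → z ∉ N.map (addRightEmbedding c) := by
      intro z hz hmem
      obtain ⟨y, hy, rfl⟩ := Finset.mem_map.1 hmem
      exact hz (by simpa using hy)
    exact hnot.imp (key _) (key _)

/-- An element of weight one is followed by elements at distance five, up to the end or up to a
shorter step. -/
theorem run (W : PositiveWalk m ℓ α f) {b : ℤ} (hα : α b) (hf : f b = 1) (hb : 0 ≤ b) (n : ℕ)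
    (hn : b + 5 * n + 1 ≤ m) :
    (∀ j : ℕ, j ≤ n → α (b + 5 * j) ∧ f (b + 5 * j) = 1) ∨
    ∃ j : ℕ, j < n ∧ (∀ i : ℕ, i ≤ j → α (b + 5 * i)) ∧ ∃ g, 1 ≤ g ∧ g ≤ 4 ∧
      α (b + 5 * j + g) ∧ f (b + 5 * j + g) = 6 - g ∧
      ∀ x, b + 5 * j < x → x < b + 5 * j + g → ¬ α x := by
  induction n with
  | zero =>
    left
    intro j hj
    obtain rfl : j = 0 := by omega
    simpa using ⟨hα, hf⟩
  | succ n ih =>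
    push_cast at hn
    rcases ih (by omega) with h | ⟨j, hj, h⟩
    · obtain ⟨h1, h2⟩ := h n le_rfl
      obtain ⟨g, hg, hg', h3, h4, h5⟩ := W.next h1 h2 (by omega)
      by_cases hg5 : g = 5
      · left
        intro j hj
        rcases hj.lt_or_eq with hj | rfl
        · exact h j (by omega)
        · subst hg5
          push_cast
          rw [show b + 5 * ((n : ℤ) + 1) = b + 5 * n + 5 by ring]
          exact ⟨h3, by omega⟩
      · exact Or.inr ⟨n, by omega, fun i hi => (h i hi).1, g, hg, by omega, h3, by omega, h5⟩
    · exact Or.inr ⟨j, by omega, h⟩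

end PositiveWalk

end Walk

/-! ### Case analysis of walks with one or two overlaps. -/

section WalkCases

namespace PositiveWalk

variable {m q : ℤ} {α : ℤ → Prop} {f : ℤ → ℤ}

/-- With a single overlap and period `5 * q + 4`, the gaps are one `4` and otherwise `5`, which
leaves two unreached elements around the gap `4`. -/
theorem exists_unreached_of_one_overlap_four (W : PositiveWalk m 1 α f) (hmq : m = 5 * q + 4)
    (hm : 14 ≤ m) : ∃ c, Unreached α (c - 3) ∧ Unreached α (c + 2) := by
  have h0 := W.mem_zero (by omega)
  have f0 := W.zero
  obtain ⟨g, hg, hg', h, e, n⟩ := W.next h0 f0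
  interval_cases g
  · have h1 : α 1 := h
    have f1 : f 1 = 4 := e
    obtain ⟨g, hg, hg', h, e, n⟩ := W.next_of_exhausted (W.exhausted {0, 1} 1 (by simpa using ⟨h0, h1⟩)) h1 f1
    obtain rfl | rfl : g = 5 ∨ g = 8 := by omega
    · exact (W.not_loss {0, 1, 6} 14 hm (by simpa using ⟨h0, h1, h⟩)).elim
    · exact (W.not_rest_end {0, 1} (-5) 14 hm (by simpa using ⟨h0, h1⟩) h e).elim
  · exact (W.not_rest_end {0, 2} (-7) 14 hm (by simpa using ⟨h0, h⟩) h e).elim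
  · exact (W.not_rest_end {0, 3} (-6) 14 hm (by simpa using ⟨h0, h⟩) h e).elim
  · have h4 : α 4 := h
    have f4 : f 4 = 1 := e
    have hE := W.exhausted {0, 4} 4 (by simpa using ⟨h0, h4⟩)
    have hn5 : α (-5) := W.rest_end hE h4 f4 _
    have hn10 : α (-10) := W.rest_end hE h4 f4 _
    have h9 : α 9 := by simpa using (W.rest hE h4 f4 1).1
    exact ⟨0, .of_eq (fun hn3 => W.not_loss {-3, 0, 4} 14 hm (by simpa using ⟨hn3, h0, h4⟩)) hn10 hn5 h0 h4,
      .of_eq (fun h2 => W.not_loss {0, 2, 4} 14 hm (by simpa using ⟨h0, h2, h4⟩)) hn5 h0 h4 h9⟩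

/-- With a single overlap and period `5 * q + 3`, the gaps are one `3` and otherwise `5`, which
leaves four unreached elements around the gap `3`. -/
theorem exists_unreached_of_one_overlap_three (W : PositiveWalk m 1 α f) (hmq : m = 5 * q + 3)
    (hm : 23 ≤ m) : ∃ c, Unreached α (c - 3) ∧ Unreached α (c + 1) ∧ Unreached α (c + 6) ∧
      Unreached α (c + 7) := by
  have h0 := W.mem_zero (by omega)
  have f0 := W.zero
  obtain ⟨g, hg, hg', h, e, n⟩ := W.next h0 f0
  interval_cases g
  · have h1 : α 1 := h
    have f1 : f 1 = 4 := e
    rcases W.rest_end_four (W.exhausted {0, 1} 1 (by simpa using ⟨h0, h1⟩)) h1 f1 (-7) with hn7 | h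
    · exact (W.not_loss {-7, 0, 1} 23 hm (by simpa using ⟨hn7, h0, h1⟩)).elim
    · have hn4 : α (-4) := by simpa using h
      exact (W.not_loss {-4, 0, 1} 23 hm (by simpa using ⟨hn4, h0, h1⟩)).elim
  · exact (W.not_rest_end {0, 2} (-6) 23 hm (by simpa using ⟨h0, h⟩) h e).elim
  · have h3 : α 3 := h
    have f3 : f 3 = 2 := e
    have hE := W.exhausted {0, 3} 3 (by simpa using ⟨h0, h3⟩)
    have hn5 : α (-5) := W.rest_end hE h3 f3 _
    have hn10 : α (-10) := W.rest_end hE h3 f3 _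
    have h8 : α 8 := by simpa using (W.rest hE h3 f3 1).1
    have h13 : α 13 := by simpa using (W.rest hE h3 f3 2).1
    exact ⟨0,
      .of_eq (fun hn3 => W.not_loss {-3, 0, 3} 23 hm (by simpa using ⟨hn3, h0, h3⟩)) hn10 hn5 h0 h3,
      .of_eq (fun h1 => W.not_loss {0, 1, 3} 23 hm (by simpa using ⟨h0, h1, h3⟩)) h0 hn5 h3 h8,
      .of_eq (fun h6 => W.not_loss {0, 3, 6} 23 hm (by simpa using ⟨h0, h3, h6⟩)) h3 h0 h8 h13,
      .of_eq (fun h7 => W.not_loss {0, 3, 7} 23 hm (by simpa using ⟨h0, h3, h7⟩)) h0 h8 h3 h13⟩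
  · exact (W.not_rest_end {0, 4} (-4) 23 hm (by simpa using ⟨h0, h⟩) h e).elim

/-- Branching on successive gaps from the start of the walk. A branch closes when a third overlap
appears, possibly because the forced steps of five arrive too close to 0 at the end of the period,
or when an unreached vertex is exhibited. -/
theorem exists_unreached_of_two_overlaps (W : PositiveWalk m 2 α f) (hmq : m = 5 * q + 4)
    (hm : 19 ≤ m) (hU : ∀ x, ¬ Unreached α x) : False := by
  have h0 := W.mem_zero (by omega)
  have f0 := W.zero
  obtain ⟨g, hg, hg', h, e, n⟩ := W.next h0 f0
  interval_cases g
  · have h1 : α 1 := h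
    have f1 : f 1 = 4 := e
    obtain ⟨g, hg, hg', h, e, n⟩ := W.next h1 f1
    interval_cases g
    · exact W.not_loss {0, 1, 2} 19 hm (by simpa using ⟨h0, h1, h⟩)
    · exact W.not_loss {0, 1, 3} 19 hm (by simpa using ⟨h0, h1, h⟩)
    · exact W.not_loss {0, 1, 4} 19 hm (by simpa using ⟨h0, h1, h⟩)
    · have h5 : α 5 := h
      have f5 : f 5 = 5 := e
      have g5 : ∀ x, 1 < x → x < 5 → ¬ α x := n
      obtain ⟨g, hg, hg', h, e, n⟩ := W.next_of_exhausted (W.exhausted {0, 1, 5} 5 (by simpa using ⟨h0, h1, h5⟩)) h5 f5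
      obtain rfl | rfl | rfl : g = 5 ∨ g = 8 ∨ g = 9 := by omega
      · have h10 : α 10 := h
        exact hU _ (.of_eq (x := 3) (g5 3 (by norm_num) (by norm_num)) h0 h1 h5 h10)
      · exact W.not_rest_end {0, 1, 5} (-6) 19 hm (by simpa using ⟨h0, h1, h5⟩) h e
      · exact W.not_rest_end {0, 1, 5} (-5) 19 hm (by simpa using ⟨h0, h1, h5⟩) h e
    · have h6 : α 6 := h
      have f6 : f 6 = 4 := e
      rcases W.rest_end_four (W.exhausted {0, 1, 6} 6 (by simpa using ⟨h0, h1, h6⟩)) h6 f6 (-8) with hn8 | h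
      · exact hU _ (.of_eq (x := -1) (fun hn1 => W.not_loss {-1, 0, 1} 19 hm (by simpa using ⟨hn1, h0, h1⟩)) hn8 h0 h1 h6)
      · have hn5 : α (-5) := by simpa using h
        exact W.not_loss {-5, 0, 1, 6} 19 hm (by simpa using ⟨hn5, h0, h1, h6⟩)
    · exact W.not_loss {0, 1, 7} 19 hm (by simpa using ⟨h0, h1, h⟩)
    · exact W.not_rest_end {0, 1, 8} (-6) 19 hm (by simpa using ⟨h0, h1, h⟩) h e
    · have h9 : α 9 := h
      have f9 : f 9 = 1 := e
      have g9 : ∀ x, 1 < x → x < 9 → ¬ α x := n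
      obtain ⟨g, hg, hg', h, e, n⟩ := W.next h9 f9
      interval_cases g
      · have h10 : α 10 := h
        have f10 : f 10 = 5 := e
        -- A further step from 10 at weight 5 needs m ≥ 20. For m = 19 the elements 9 and 10
        -- reappear as -10 and -9.
        rcases (by omega : m = 19 ∨ 24 ≤ m) with rfl | hm'
        · have hn10 : α (-10) := (W.periodic _).1 (by simpa using h9)
          have hn9 : α (-9) := (W.periodic _).1 (by simpa using h10)
          exact hU _ (.of_eq (x := -3) (fun hn3 => W.not_loss {-10, -9, -3, 0, 1} 19 hm (by simpa using ⟨hn10, hn9, hn3, h0, h1⟩))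
            hn10 hn9 h0 h1)
        · obtain ⟨g, hg, hg', h, e, n⟩ := W.next_of_exhausted (W.exhausted {0, 1, 9, 10} 10 (by simpa using ⟨h0, h1, h9, h10⟩)) h10 f10
          obtain rfl | rfl | rfl : g = 5 ∨ g = 8 ∨ g = 9 := by omega
          · exact W.not_loss {0, 1, 9, 10, 15} 24 hm' (by simpa using ⟨h0, h1, h9, h10, h⟩)
          · exact W.not_rest_end {0, 1, 9, 10} (-6) 24 hm' (by simpa using ⟨h0, h1, h9, h10⟩) h e
          · exact W.not_rest_end {0, 1, 9, 10} (-5) 24 hm' (by simpa using ⟨h0, h1, h9, h10⟩) h e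
      · have h11 : α 11 := h
        exact hU _ (.of_eq (x := 7) (g9 7 (by norm_num) (by norm_num)) h0 h1 h9 h11)
      · have h12 : α 12 := h
        have f12 : f 12 = 3 := e
        rcases (by omega : m = 19 ∨ 24 ≤ m) with rfl | hm'
        · have hn10 : α (-10) := (W.periodic _).1 (by simpa using h9)
          have hn7 : α (-7) := (W.periodic _).1 (by simpa using h12)
          exact W.not_loss {-10, -7, 0, 1} 19 hm (by simpa using ⟨hn10, hn7, h0, h1⟩)
        · exact W.not_rest_end {0, 1, 9, 12} (-7) 24 hm' (by simpa using ⟨h0, h1, h9, h12⟩) h12 f12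
      · have h13 : α 13 := h
        exact hU _ (.of_eq (x := 7) (g9 7 (by norm_num) (by norm_num)) h0 h1 h9 h13)
      · have h14 : α 14 := h
        exact hU _ (.of_eq (x := 7) (g9 7 (by norm_num) (by norm_num)) h0 h1 h9 h14)
  · have h2 : α 2 := h
    have f2 : f 2 = 3 := e
    obtain ⟨g, hg, hg', h, e, n⟩ := W.next h2 f2
    interval_cases g
    · have h3 : α 3 := h
      have f3 : f 3 = 7 := e
      obtain ⟨g, hg, hg', h, e, n⟩ := W.next_of_exhausted (W.exhausted {0, 2, 3} 3 (by simpa using ⟨h0, h2, h3⟩)) h3 f3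
      obtain rfl | rfl | rfl | rfl | rfl : g = 5 ∨ g = 8 ∨ g = 9 ∨ g = 10 ∨ g = 11 := by omega
      · exact W.not_loss {0, 2, 3, 8} 19 hm (by simpa using ⟨h0, h2, h3, h⟩)
      · have h11 : α 11 := h
        have g11 : ∀ x, 3 < x → x < 11 → ¬ α x := n
        exact hU _ (.of_eq (x := 4) (g11 4 (by norm_num) (by norm_num)) h3 h2 h0 h11)
      · have h12 : α 12 := h
        have g12 : ∀ x, 3 < x → x < 12 → ¬ α x := n
        exact hU _ (.of_eq (x := 6) (g12 6 (by norm_num) (by norm_num)) h3 h0 h2 h12)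
      · have h13 : α 13 := h
        have g13 : ∀ x, 3 < x → x < 13 → ¬ α x := n
        exact hU _ (.of_eq (x := 6) (g13 6 (by norm_num) (by norm_num)) h3 h0 h2 h13)
      · exact W.not_rest_end {0, 2, 3} (-5) 19 hm (by simpa using ⟨h0, h2, h3⟩) h e
    · exact W.not_loss {0, 2, 4} 19 hm (by simpa using ⟨h0, h2, h⟩)
    · have h5 : α 5 := h
      have f5 : f 5 = 5 := e
      obtain ⟨g, hg, hg', h, e, n⟩ := W.next_of_exhausted (W.exhausted {0, 2, 5} 5 (by simpa using ⟨h0, h2, h5⟩)) h5 f5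
      obtain rfl | rfl | rfl : g = 5 ∨ g = 8 ∨ g = 9 := by omega
      · have h10 : α 10 := h
        have g10 : ∀ x, 5 < x → x < 10 → ¬ α x := n
        exact hU _ (.of_eq (x := 6) (g10 6 (by norm_num) (by norm_num)) h5 h0 h2 h10)
      · have h13 : α 13 := h
        have g13 : ∀ x, 5 < x → x < 13 → ¬ α x := n
        exact hU _ (.of_eq (x := 6) (g13 6 (by norm_num) (by norm_num)) h5 h0 h2 h13)
      · exact W.not_rest_end {0, 2, 5} (-5) 19 hm (by simpa using ⟨h0, h2, h5⟩) h e
    · exact W.not_loss {0, 2, 6} 19 hm (by simpa using ⟨h0, h2, h⟩)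
    · exact W.not_rest_end {0, 2, 7} (-7) 19 hm (by simpa using ⟨h0, h2, h⟩) h e
    · exact W.not_rest_end {0, 2, 8} (-6) 19 hm (by simpa using ⟨h0, h2, h⟩) h e
    · exact W.not_rest_end {0, 2, 9} (-5) 19 hm (by simpa using ⟨h0, h2, h⟩) h e
  · have h3 : α 3 := h
    have f3 : f 3 = 2 := e
    obtain ⟨g, hg, hg', h, e, n⟩ := W.next h3 f3
    interval_cases g
    · exact W.not_loss {0, 3, 4} 19 hm (by simpa using ⟨h0, h3, h⟩)
    · have h5 : α 5 := h
      have f5 : f 5 = 5 := e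
      obtain ⟨g, hg, hg', h, e, n⟩ := W.next_of_exhausted (W.exhausted {0, 3, 5} 5 (by simpa using ⟨h0, h3, h5⟩)) h5 f5
      obtain rfl | rfl | rfl : g = 5 ∨ g = 8 ∨ g = 9 := by omega
      · exact W.not_loss {0, 3, 5, 10} 19 hm (by simpa using ⟨h0, h3, h5, h⟩)
      · have h13 : α 13 := h
        have g13 : ∀ x, 5 < x → x < 13 → ¬ α x := n
        exact hU _ (.of_eq (x := 7) (g13 7 (by norm_num) (by norm_num)) h0 h5 h3 h13)
      · have h14 : α 14 := h
        have g14 : ∀ x, 5 < x → x < 14 → ¬ α x := n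
        exact hU _ (.of_eq (x := 7) (g14 7 (by norm_num) (by norm_num)) h0 h5 h3 h14)
    · exact W.not_loss {0, 3, 6} 19 hm (by simpa using ⟨h0, h3, h⟩)
    · exact W.not_loss {0, 3, 7} 19 hm (by simpa using ⟨h0, h3, h⟩)
    · have h8 : α 8 := h
      have f8 : f 8 = 2 := e
      have g8 : ∀ x, 3 < x → x < 8 → ¬ α x := n
      obtain ⟨g, hg, hg', h, e, n⟩ := W.next h8 f8
      interval_cases g
      · exact W.not_loss {0, 3, 8, 9} 19 hm (by simpa using ⟨h0, h3, h8, h⟩)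
      · exact W.not_loss {0, 3, 8, 10} 19 hm (by simpa using ⟨h0, h3, h8, h⟩)
      · have h11 : α 11 := h
        exact hU _ (.of_eq (x := 7) (g8 7 (by norm_num) (by norm_num)) h0 h8 h3 h11)
      · have h12 : α 12 := h
        exact hU _ (.of_eq (x := 6) (g8 6 (by norm_num) (by norm_num)) h3 h0 h8 h12)
      · have h13 : α 13 := h
        exact hU _ (.of_eq (x := 6) (g8 6 (by norm_num) (by norm_num)) h3 h0 h8 h13)
      · have h14 : α 14 := h
        exact hU _ (.of_eq (x := 7) (g8 7 (by norm_num) (by norm_num)) h0 h8 h3 h14)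
    · have h9 : α 9 := h
      have f9 : f 9 = 1 := e
      have hE := W.exhausted {0, 3, 9} 9 (by simpa using ⟨h0, h3, h9⟩)
      have hn5 : α (-5) := W.rest_end hE h9 f9 _
      have hn10 : α (-10) := W.rest_end hE h9 f9 _
      exact hU _ (.of_eq (x := -3) (fun hn3 => W.not_loss {-3, 0, 3} 19 hm (by simpa using ⟨hn3, h0, h3⟩)) hn10 hn5 h0 h3)
  · have h4 : α 4 := h
    have f4 : f 4 = 1 := e
    have g4 : ∀ x, 0 < x → x < 4 → ¬ α x := n
    obtain ⟨g, hg, hg', h, e, n⟩ := W.next h4 f4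
    interval_cases g
    · have h5 : α 5 := h
      have f5 : f 5 = 5 := e
      obtain ⟨g, hg, hg', h, e, n⟩ := W.next_of_exhausted (W.exhausted {0, 4, 5} 5 (by simpa using ⟨h0, h4, h5⟩)) h5 f5
      obtain rfl | rfl | rfl : g = 5 ∨ g = 8 ∨ g = 9 := by omega
      · exact W.not_loss {0, 4, 5, 10} 19 hm (by simpa using ⟨h0, h4, h5, h⟩)
      · exact W.not_rest_end {0, 4, 5} (-6) 19 hm (by simpa using ⟨h0, h4, h5⟩) h e
      · have h14 : α 14 := h
        have f14 : f 14 = 1 := e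
        have hE := W.exhausted {0, 4, 5} 14 (by simpa using ⟨h0, h4, h5⟩)
        have hn5 : α (-5) := W.rest_end hE h14 f14 _
        exact hU _ (.of_eq (x := 1) (g4 1 (by norm_num) (by norm_num)) h0 hn5 h4 h5)
    · have h6 : α 6 := h
      have f6 : f 6 = 4 := e
      obtain ⟨g, hg, hg', h, e, n⟩ := W.next_of_exhausted (W.exhausted {0, 4, 6} 6 (by simpa using ⟨h0, h4, h6⟩)) h6 f6
      obtain rfl | rfl : g = 5 ∨ g = 8 := by omega
      · exact W.not_loss {0, 4, 6, 11} 19 hm (by simpa using ⟨h0, h4, h6, h⟩)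
      · have h14 : α 14 := h
        have f14 : f 14 = 1 := e
        have hE := W.exhausted {0, 4, 6} 14 (by simpa using ⟨h0, h4, h6⟩)
        have hn5 : α (-5) := W.rest_end hE h14 f14 _
        exact hU _ (.of_eq (x := 2) (g4 2 (by norm_num) (by norm_num)) hn5 h0 h4 h6)
    · exact W.not_rest_end {0, 4, 7} (-7) 19 hm (by simpa using ⟨h0, h4, h⟩) h e
    · exact W.not_rest_end {0, 4, 8} (-6) 19 hm (by simpa using ⟨h0, h4, h⟩) h e
    · have h9 : α 9 := h
      have f9 : f 9 = 1 := e
      -- One overlap is still unused and may occur after any number of gaps of 5. Either these go on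
      -- to 9 + 5(q - 2) = m - 5, or there is a first shorter gap, starting at c.
      rcases W.run h9 f9 (by norm_num) (q - 2).toNat (by omega) with hr | ⟨j, hj, hr, g, hg, hg', h, e, n⟩
      · have hn5 : α (-5) := by
          have h := (hr (q - 2).toNat (by omega)).1
          rw [show 9 + 5 * (((q - 2).toNat : ℕ) : ℤ) = -5 + m by omega] at h
          exact (W.periodic _).1 h
        exact hU _ (.of_eq (x := 2) (g4 2 (by norm_num) (by norm_num)) hn5 h0 h4 h9)
      · obtain ⟨c, hc⟩ : ∃ c : ℤ, c = 9 + 5 * j := ⟨_, rfl⟩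
        rw [← hc] at h e n
        have hc0 : α c := hc ▸ hr j le_rfl
        have hc5 : α (-5 + c) := by
          rcases j with _ | j
          · rw [hc]; simpa using h4
          · have h := hr j (by omega)
            rwa [show 9 + 5 * (j : ℤ) = -5 + c by push_cast at hc; omega] at h
        interval_cases g
        -- A gap of 1 or 2 after c also puts the new element at distance 6 or 7 from c - 5. This
        -- costs two overlaps in addition to the pair (0, 4).
        · exact W.not_overlap_translate {-5, 0, 1} c 0 0 4
            (by simpa using ⟨hc5, hc0, by rwa [add_comm] at h⟩) h0 h4 (by simp; omega) le_rfl (by omega)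
            (by simp; omega)
        · exact W.not_overlap_translate {-5, 0, 2} c 0 0 4
            (by simpa using ⟨hc5, hc0, by rwa [add_comm] at h⟩) h0 h4 (by simp; omega) le_rfl (by omega)
            (by simp; omega)
        · have hE := W.exhausted_pair {0, 4} c 3 (by simpa using ⟨h0, h4⟩) hc0 h (by simp; omega) (by omega)
          -- The elements -7, 0, 4 already lose two. Their translates by m lie in the period
          -- starting at c, which also contains the third overlap (c, c + 3).
          have hn7 : α (-7) := W.rest_end hE h e _ (by omega)
          exact W.not_overlap_translate {-7, 0, 4} m c c 3
            (by simpa using ⟨(W.periodic _).2 hn7, by simpa using (W.periodic 0).2 h0, (W.periodic _).2 h4⟩)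
            hc0 h (by simp; omega) le_rfl (by omega) (by simp; omega)
        · have hE := W.exhausted_pair {0, 4} c 4 (by simpa using ⟨h0, h4⟩) hc0 h (by simp; omega) (by omega)
          have hn6 : α (-6) := W.rest_end hE h e _ (by omega)
          exact W.not_overlap_translate {-6, 0, 4} m c c 4
            (by simpa using ⟨(W.periodic _).2 hn6, by simpa using (W.periodic 0).2 h0, (W.periodic _).2 h4⟩)
            hc0 h (by simp; omega) le_rfl (by omega) (by simp; omega)

/-- The same branching as for period 5 * q + 4. Two unreached vertices are needed here because one
left vertex is allowed to stay undominated. -/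
theorem exists_two_unreached_of_two_overlaps (W : PositiveWalk m 2 α f) (hmq : m = 5 * q + 3)
    (hm : 23 ≤ m) (hU : ∀ x y, Unreached α x → Unreached α y → 0 < y - x → y - x < m → False) :
    False := by
  have h0 := W.mem_zero (by omega)
  have f0 := W.zero
  obtain ⟨g, hg, hg', h, e, n⟩ := W.next h0 f0
  interval_cases g
  · have h1 : α 1 := h
    have f1 : f 1 = 4 := e
    obtain ⟨g, hg, hg', h, e, n⟩ := W.next h1 f1
    interval_cases g
    · exact W.not_loss {0, 1, 2} 23 hm (by simpa using ⟨h0, h1, h⟩)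
    · exact W.not_loss {0, 1, 3} 23 hm (by simpa using ⟨h0, h1, h⟩)
    · exact W.not_loss {0, 1, 4} 23 hm (by simpa using ⟨h0, h1, h⟩)
    · have h5 : α 5 := h
      have f5 : f 5 = 5 := e
      have g5 : ∀ x, 1 < x → x < 5 → ¬ α x := n
      obtain ⟨g, hg, hg', h, e, n⟩ := W.next_of_exhausted (W.exhausted {0, 1, 5} 5 (by simpa using ⟨h0, h1, h5⟩)) h5 f5
      obtain rfl | rfl | rfl : g = 5 ∨ g = 8 ∨ g = 9 := by omega
      · have h10 : α 10 := h
        exact hU _ _ (.of_eq (x := 3) (g5 3 (by norm_num) (by norm_num)) h0 h1 h5 h10)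
          (.of_eq (x := 4) (g5 4 (by norm_num) (by norm_num)) h1 h5 h0 h10)
          (by norm_num) (by omega)
      · exact W.not_rest_end {0, 1, 5} (-5) 23 hm (by simpa using ⟨h0, h1, h5⟩) h e
      · exact W.not_rest_end {0, 1, 5} (-4) 23 hm (by simpa using ⟨h0, h1, h5⟩) h e
    · have h6 : α 6 := h
      have f6 : f 6 = 4 := e
      rcases W.rest_end_four (W.exhausted {0, 1, 6} 6 (by simpa using ⟨h0, h1, h6⟩)) h6 f6 (-7) with hn7 | h
      · exact W.not_loss {-7, 0, 1, 6} 23 hm (by simpa using ⟨hn7, h0, h1, h6⟩)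
      · have hn4 : α (-4) := by simpa using h
        exact W.not_loss {-4, 0, 1, 6} 23 hm (by simpa using ⟨hn4, h0, h1, h6⟩)
    · exact W.not_loss {0, 1, 7} 23 hm (by simpa using ⟨h0, h1, h⟩)
    · exact W.not_rest_end {0, 1, 8} (-5) 23 hm (by simpa using ⟨h0, h1, h⟩) h e
    · have h9 : α 9 := h
      have f9 : f 9 = 1 := e
      have g9 : ∀ x, 1 < x → x < 9 → ¬ α x := n
      obtain ⟨g, hg, hg', h, e, n⟩ := W.next h9 f9
      interval_cases g
      · have h10 : α 10 := h
        have f10 : f 10 = 5 := e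
        obtain ⟨g, hg, hg', h, e, n⟩ := W.next_of_exhausted (W.exhausted {0, 1, 9, 10} 10 (by simpa using ⟨h0, h1, h9, h10⟩)) h10 f10
        obtain rfl | rfl | rfl : g = 5 ∨ g = 8 ∨ g = 9 := by omega
        · exact W.not_loss {0, 1, 9, 10, 15} 23 hm (by simpa using ⟨h0, h1, h9, h10, h⟩)
        · exact W.not_rest_end {0, 1, 9, 10} (-5) 23 hm (by simpa using ⟨h0, h1, h9, h10⟩) h e
        · exact W.not_rest_end {0, 1, 9, 10} (-4) 23 hm (by simpa using ⟨h0, h1, h9, h10⟩) h e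
      · have h11 : α 11 := h
        have f11 : f 11 = 4 := e
        rcases W.rest_end_four (W.exhausted {0, 1, 9, 11} 11 (by simpa using ⟨h0, h1, h9, h11⟩)) h11 f11 (-7) with hn7 | h
        · exact W.not_loss {-7, 0, 1, 9, 11} 23 hm (by simpa using ⟨hn7, h0, h1, h9, h11⟩)
        · have hn4 : α (-4) := by simpa using h
          exact W.not_loss {-4, 0, 1, 9, 11} 23 hm (by simpa using ⟨hn4, h0, h1, h9, h11⟩)
      · exact W.not_rest_end {0, 1, 9, 12} (-6) 23 hm (by simpa using ⟨h0, h1, h9, h⟩) h e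
      · exact W.not_rest_end {0, 1, 9, 13} (-5) 23 hm (by simpa using ⟨h0, h1, h9, h⟩) h e
      · have h14 : α 14 := h
        have f14 : f 14 = 1 := e
        rcases W.run h14 f14 (by norm_num) (q - 3).toNat (by omega) with hr | ⟨j, hj, hr, g, hg, hg', h, e, n⟩
        · have hn4 : α (-4) := by
            have h := (hr (q - 3).toNat (by omega)).1
            rw [show 14 + 5 * (((q - 3).toNat : ℕ) : ℤ) = -4 + m by omega] at h
            exact (W.periodic _).1 h
          have hn9 : α (-9) := by
            have h := (hr (q - 4).toNat (by omega)).1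
            rw [show 14 + 5 * (((q - 4).toNat : ℕ) : ℤ) = -9 + m by omega] at h
            exact (W.periodic _).1 h
          exact hU _ _ (.of_eq (x := -3) (fun hn3 => W.not_loss {-4, -3, 0, 1} 23 hm (by simpa using ⟨hn4, hn3, h0, h1⟩)) hn4 hn9 h0 h1)
            (.of_eq (x := 7) (g9 7 (by norm_num) (by norm_num)) h0 h1 h9 h14)
            (by norm_num) (by omega)
        · obtain ⟨c, hc⟩ : ∃ c : ℤ, c = 14 + 5 * j := ⟨_, rfl⟩
          rw [← hc] at h e n
          have hc0 : α c := hc ▸ hr j le_rfl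
          have hc5 : α (-5 + c) := by
            rcases j with _ | j
            · rw [hc]; simpa using h9
            · have h := hr j (by omega)
              rwa [show 14 + 5 * (j : ℤ) = -5 + c by push_cast at hc; omega] at h
          interval_cases g
          · exact W.not_overlap_translate {-5, 0, 1} c 0 0 1
              (by simpa using ⟨hc5, hc0, by rwa [add_comm] at h⟩) h0 h1 (by simp; omega) le_rfl (by omega)
              (by simp; omega)
          · exact W.not_overlap_translate {-5, 0, 2} c 0 0 1
              (by simpa using ⟨hc5, hc0, by rwa [add_comm] at h⟩) h0 h1 (by simp; omega) le_rfl (by omega)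
              (by simp; omega)
          · have hE := W.exhausted_pair {0, 1} c 3 (by simpa using ⟨h0, h1⟩) hc0 h (by simp; omega) (by omega)
            have hn6 : α (-6) := W.rest_end hE h e _ (by omega)
            exact W.not_overlap_translate {-6, 0, 1} m c c 3
              (by simpa using ⟨(W.periodic _).2 hn6, by simpa using (W.periodic 0).2 h0, (W.periodic _).2 h1⟩)
              hc0 h (by simp; omega) le_rfl (by omega) (by simp; omega)
          · have hE := W.exhausted_pair {0, 1} c 4 (by simpa using ⟨h0, h1⟩) hc0 h (by simp; omega) (by omega)
            have hn5 : α (-5) := W.rest_end hE h e _ (by omega)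
            exact W.not_overlap_translate {-5, 0, 1} m c c 4
              (by simpa using ⟨(W.periodic _).2 hn5, by simpa using (W.periodic 0).2 h0, (W.periodic _).2 h1⟩)
              hc0 h (by simp; omega) le_rfl (by omega) (by simp; omega)
  · have h2 : α 2 := h
    have f2 : f 2 = 3 := e
    obtain ⟨g, hg, hg', h, e, n⟩ := W.next h2 f2
    interval_cases g
    · have h3 : α 3 := h
      have f3 : f 3 = 7 := e
      obtain ⟨g, hg, hg', h, e, n⟩ := W.next_of_exhausted (W.exhausted {0, 2, 3} 3 (by simpa using ⟨h0, h2, h3⟩)) h3 f3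
      obtain rfl | rfl | rfl | rfl | rfl : g = 5 ∨ g = 8 ∨ g = 9 ∨ g = 10 ∨ g = 11 := by omega
      · exact W.not_loss {0, 2, 3, 8} 23 hm (by simpa using ⟨h0, h2, h3, h⟩)
      · have h11 : α 11 := h
        have f11 : f 11 = 4 := e
        rcases W.rest_end_four (W.exhausted {0, 2, 3} 11 (by simpa using ⟨h0, h2, h3⟩)) h11 f11 (-7) with hn7 | h
        · exact W.not_loss {-7, 0, 2, 3} 23 hm (by simpa using ⟨hn7, h0, h2, h3⟩)
        · have hn4 : α (-4) := by simpa using h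
          exact W.not_loss {-4, 0, 2, 3} 23 hm (by simpa using ⟨hn4, h0, h2, h3⟩)
      · exact W.not_rest_end {0, 2, 3} (-6) 23 hm (by simpa using ⟨h0, h2, h3⟩) h e
      · exact W.not_rest_end {0, 2, 3} (-5) 23 hm (by simpa using ⟨h0, h2, h3⟩) h e
      · exact W.not_rest_end {0, 2, 3} (-4) 23 hm (by simpa using ⟨h0, h2, h3⟩) h e
    · exact W.not_loss {0, 2, 4} 23 hm (by simpa using ⟨h0, h2, h⟩)
    · have h5 : α 5 := h
      have f5 : f 5 = 5 := e
      obtain ⟨g, hg, hg', h, e, n⟩ := W.next_of_exhausted (W.exhausted {0, 2, 5} 5 (by simpa using ⟨h0, h2, h5⟩)) h5 f5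
      obtain rfl | rfl | rfl : g = 5 ∨ g = 8 ∨ g = 9 := by omega
      · have h10 : α 10 := h
        have f10 : f 10 = 5 := e
        have g10 : ∀ x, 5 < x → x < 10 → ¬ α x := n
        obtain ⟨g, hg, hg', h, e, n⟩ := W.next_of_exhausted (W.exhausted {0, 2, 5} 10 (by simpa using ⟨h0, h2, h5⟩)) h10 f10
        obtain rfl | rfl | rfl : g = 5 ∨ g = 8 ∨ g = 9 := by omega
        · have h15 : α 15 := h
          exact hU _ _ (.of_eq (x := 6) (g10 6 (by norm_num) (by norm_num)) h5 h0 h2 h10)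
            (.of_eq (x := 8) (g10 8 (by norm_num) (by norm_num)) h5 h2 h10 h15)
            (by norm_num) (by omega)
        · exact W.not_rest_end {0, 2, 5} (-5) 23 hm (by simpa using ⟨h0, h2, h5⟩) h e
        · exact W.not_rest_end {0, 2, 5} (-4) 23 hm (by simpa using ⟨h0, h2, h5⟩) h e
      · exact W.not_rest_end {0, 2, 5} (-5) 23 hm (by simpa using ⟨h0, h2, h5⟩) h e
      · exact W.not_rest_end {0, 2, 5} (-4) 23 hm (by simpa using ⟨h0, h2, h5⟩) h e
    · exact W.not_loss {0, 2, 6} 23 hm (by simpa using ⟨h0, h2, h⟩)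
    · exact W.not_rest_end {0, 2, 7} (-6) 23 hm (by simpa using ⟨h0, h2, h⟩) h e
    · exact W.not_rest_end {0, 2, 8} (-5) 23 hm (by simpa using ⟨h0, h2, h⟩) h e
    · exact W.not_rest_end {0, 2, 9} (-4) 23 hm (by simpa using ⟨h0, h2, h⟩) h e
  · have h3 : α 3 := h
    have f3 : f 3 = 2 := e
    have g3 : ∀ x, 0 < x → x < 3 → ¬ α x := n
    obtain ⟨g, hg, hg', h, e, n⟩ := W.next h3 f3
    interval_cases g
    · exact W.not_loss {0, 3, 4} 23 hm (by simpa using ⟨h0, h3, h⟩)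
    · have h5 : α 5 := h
      have f5 : f 5 = 5 := e
      obtain ⟨g, hg, hg', h, e, n⟩ := W.next_of_exhausted (W.exhausted {0, 3, 5} 5 (by simpa using ⟨h0, h3, h5⟩)) h5 f5
      obtain rfl | rfl | rfl : g = 5 ∨ g = 8 ∨ g = 9 := by omega
      · exact W.not_loss {0, 3, 5, 10} 23 hm (by simpa using ⟨h0, h3, h5, h⟩)
      · have h13 : α 13 := h
        have f13 : f 13 = 2 := e
        have g13 : ∀ x, 5 < x → x < 13 → ¬ α x := n
        have hE := W.exhausted {0, 3, 5} 13 (by simpa using ⟨h0, h3, h5⟩)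
        have hn5 : α (-5) := W.rest_end hE h13 f13 _
        exact hU _ _ (.of_eq (x := 1) (g3 1 (by norm_num) (by norm_num)) h0 hn5 h3 h5)
          (.of_eq (x := 7) (g13 7 (by norm_num) (by norm_num)) h0 h5 h3 h13)
          (by norm_num) (by omega)
      · exact W.not_rest_end {0, 3, 5} (-4) 23 hm (by simpa using ⟨h0, h3, h5⟩) h e
    · exact W.not_loss {0, 3, 6} 23 hm (by simpa using ⟨h0, h3, h⟩)
    · exact W.not_loss {0, 3, 7} 23 hm (by simpa using ⟨h0, h3, h⟩)
    · have h8 : α 8 := h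
      have f8 : f 8 = 2 := e
      have g8 : ∀ x, 3 < x → x < 8 → ¬ α x := n
      obtain ⟨g, hg, hg', h, e, n⟩ := W.next h8 f8
      interval_cases g
      · exact W.not_loss {0, 3, 8, 9} 23 hm (by simpa using ⟨h0, h3, h8, h⟩)
      · exact W.not_loss {0, 3, 8, 10} 23 hm (by simpa using ⟨h0, h3, h8, h⟩)
      · have h11 : α 11 := h
        have f11 : f 11 = 4 := e
        rcases W.rest_end_four (W.exhausted {0, 3, 8, 11} 11 (by simpa using ⟨h0, h3, h8, h11⟩)) h11 f11 (-7) with hn7 | h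
        · exact W.not_loss {-7, 0, 3, 8, 11} 23 hm (by simpa using ⟨hn7, h0, h3, h8, h11⟩)
        · have hn4 : α (-4) := by simpa using h
          exact W.not_loss {-4, 0, 3, 8, 11} 23 hm (by simpa using ⟨hn4, h0, h3, h8, h11⟩)
      · exact W.not_rest_end {0, 3, 8, 12} (-6) 23 hm (by simpa using ⟨h0, h3, h8, h⟩) h e
      · have h13 : α 13 := h
        exact hU _ _ (.of_eq (x := 6) (g8 6 (by norm_num) (by norm_num)) h3 h0 h8 h13)
          (.of_eq (x := 7) (g8 7 (by norm_num) (by norm_num)) h0 h8 h3 h13)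
          (by norm_num) (by omega)
      · exact W.not_rest_end {0, 3, 8, 14} (-4) 23 hm (by simpa using ⟨h0, h3, h8, h⟩) h e
    · exact W.not_rest_end {0, 3, 9} (-4) 23 hm (by simpa using ⟨h0, h3, h⟩) h e
  · have h4 : α 4 := h
    have f4 : f 4 = 1 := e
    have g4 : ∀ x, 0 < x → x < 4 → ¬ α x := n
    obtain ⟨g, hg, hg', h, e, n⟩ := W.next h4 f4
    interval_cases g
    · have h5 : α 5 := h
      have f5 : f 5 = 5 := e
      obtain ⟨g, hg, hg', h, e, n⟩ := W.next_of_exhausted (W.exhausted {0, 4, 5} 5 (by simpa using ⟨h0, h4, h5⟩)) h5 f5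
      obtain rfl | rfl | rfl : g = 5 ∨ g = 8 ∨ g = 9 := by omega
      · exact W.not_loss {0, 4, 5, 10} 23 hm (by simpa using ⟨h0, h4, h5, h⟩)
      · have h13 : α 13 := h
        have f13 : f 13 = 2 := e
        have hE := W.exhausted {0, 4, 5} 13 (by simpa using ⟨h0, h4, h5⟩)
        have hn5 : α (-5) := W.rest_end hE h13 f13 _
        have hn10 : α (-10) := W.rest_end hE h13 f13 _
        exact hU _ _ (.of_eq (x := -3) (fun hn3 => W.not_loss {-3, 0, 4} 23 hm (by simpa using ⟨hn3, h0, h4⟩)) hn10 hn5 h0 h4)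
          (.of_eq (x := 1) (g4 1 (by norm_num) (by norm_num)) h0 hn5 h4 h5)
          (by norm_num) (by omega)
      · exact W.not_rest_end {0, 4, 5} (-4) 23 hm (by simpa using ⟨h0, h4, h5⟩) h e
    · have h6 : α 6 := h
      have f6 : f 6 = 4 := e
      rcases W.rest_end_four (W.exhausted {0, 4, 6} 6 (by simpa using ⟨h0, h4, h6⟩)) h6 f6 (-7) with hn7 | h
      · exact W.not_loss {-7, 0, 4, 6} 23 hm (by simpa using ⟨hn7, h0, h4, h6⟩)
      · have hn4 : α (-4) := by simpa using h
        exact W.not_loss {-4, 0, 4, 6} 23 hm (by simpa using ⟨hn4, h0, h4, h6⟩)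
    · exact W.not_rest_end {0, 4, 7} (-6) 23 hm (by simpa using ⟨h0, h4, h⟩) h e
    · have h8 : α 8 := h
      have f8 : f 8 = 2 := e
      have hE := W.exhausted {0, 4, 8} 8 (by simpa using ⟨h0, h4, h8⟩)
      have hn5 : α (-5) := W.rest_end hE h8 f8 _
      exact hU _ _ (.of_eq (x := 1) (g4 1 (by norm_num) (by norm_num)) h0 hn5 h4 h8)
        (.of_eq (x := 2) (g4 2 (by norm_num) (by norm_num)) hn5 h0 h4 h8)
        (by norm_num) (by omega)
    · have h9 : α 9 := h
      have f9 : f 9 = 1 := e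
      rcases W.run h9 f9 (by norm_num) (q - 2).toNat (by omega) with hr | ⟨j, hj, hr, g, hg, hg', h, e, n⟩
      · have hn4 : α (-4) := by
          have h := (hr (q - 2).toNat (by omega)).1
          rw [show 9 + 5 * (((q - 2).toNat : ℕ) : ℤ) = -4 + m by omega] at h
          exact (W.periodic _).1 h
        have hn9 : α (-9) := by
          have h := (hr (q - 3).toNat (by omega)).1
          rw [show 9 + 5 * (((q - 3).toNat : ℕ) : ℤ) = -9 + m by omega] at h
          exact (W.periodic _).1 h
        have hn14 : α (-14) := by
          have h := (hr (q - 4).toNat (by omega)).1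
          rw [show 9 + 5 * (((q - 4).toNat : ℕ) : ℤ) = -14 + m by omega] at h
          exact (W.periodic _).1 h
        exact hU _ _ (.of_eq (x := -7) (fun hn7 => W.not_loss {-9, -7, -4, 0} 23 hm (by simpa using ⟨hn9, hn7, hn4, h0⟩)) hn14 hn9 hn4 h0)
          (.of_eq (x := -2) (fun hn2 => W.not_loss {-4, -2, 0, 4} 23 hm (by simpa using ⟨hn4, hn2, h0, h4⟩)) hn9 hn4 h0 h4)
          (by norm_num) (by omega)
      · obtain ⟨c, hc⟩ : ∃ c : ℤ, c = 9 + 5 * j := ⟨_, rfl⟩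
        rw [← hc] at h e n
        have hc0 : α c := hc ▸ hr j le_rfl
        have hc5 : α (-5 + c) := by
          rcases j with _ | j
          · rw [hc]; simpa using h4
          · have h := hr j (by omega)
            rwa [show 9 + 5 * (j : ℤ) = -5 + c by push_cast at hc; omega] at h
        interval_cases g
        · exact W.not_overlap_translate {-5, 0, 1} c 0 0 4
            (by simpa using ⟨hc5, hc0, by rwa [add_comm] at h⟩) h0 h4 (by simp; omega) le_rfl (by omega)
            (by simp; omega)
        · exact W.not_overlap_translate {-5, 0, 2} c 0 0 4
            (by simpa using ⟨hc5, hc0, by rwa [add_comm] at h⟩) h0 h4 (by simp; omega) le_rfl (by omega)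
            (by simp; omega)
        · have hE := W.exhausted_pair {0, 4} c 3 (by simpa using ⟨h0, h4⟩) hc0 h (by simp; omega) (by omega)
          have hn6 : α (-6) := W.rest_end hE h e _ (by omega)
          exact W.not_overlap_translate {-6, 0, 4} m c c 3
            (by simpa using ⟨(W.periodic _).2 hn6, by simpa using (W.periodic 0).2 h0, (W.periodic _).2 h4⟩)
            hc0 h (by simp; omega) le_rfl (by omega) (by simp; omega)
        · have hE := W.exhausted_pair {0, 4} c 4 (by simpa using ⟨h0, h4⟩) hc0 h (by simp; omega) (by omega)
          have hn5 : α (-5) := W.rest_end hE h e _ (by omega)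
          have hc9 : α (c + 9) := by
            -- The element after c + 4 may already be the first element m of the next period.
            rcases (by omega : c + 9 = m ∨ c + 14 ≤ m) with h' | h'
            · rw [h']; simpa using (W.periodic 0).2 h0
            · have := (W.rest hE h e 1 (by omega) (by norm_num) (by norm_num) (by push_cast; omega)).1
              rwa [show c + 4 + 5 * ((1 : ℕ) : ℤ) = c + 9 by push_cast; ring] at this
          -- Both short gaps have length 4, starting at 0 and at c, with gaps of 5 around them; each
          -- leaves the vertex two after its start unreached.
          exact hU _ _ (.of_eq (x := 2) (g4 2 (by norm_num) (by norm_num)) hn5 h0 h4 h9)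
            (.of_eq (x := c + 2) (n _ (by omega) (by omega)) hc5 hc0 h hc9) (by omega) (by omega)

end PositiveWalk

end WalkCases

/-! ### Spreads modulo m and the cycle lemma. -/

section Spread

variable {m : ℕ}

/-- The right vertices adjacent to a left vertex in `A`. -/
def spread (A : Finset (ZMod m)) : Finset (ZMod m) :=
  A.biUnion fun x => {x, x + 1, x + 3, x + 7}

theorem mem_spread {A : Finset (ZMod m)} {x : ZMod m} :
    x ∈ spread A ↔ x ∈ A ∨ x - 1 ∈ A ∨ x - 3 ∈ A ∨ x - 7 ∈ A := by
  simp only [spread, Finset.mem_biUnion, Finset.mem_insert, Finset.mem_singleton]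
  constructor
  · rintro ⟨a, ha, rfl | rfl | rfl | rfl⟩ <;> simp [ha]
  · rintro (h | h | h | h)
    · exact ⟨_, h, by simp⟩
    · exact ⟨_, h, by simp⟩
    · exact ⟨_, h, by simp⟩
    · exact ⟨_, h, by simp⟩

theorem card_spread_le (A : Finset (ZMod m)) : (spread A).card ≤ 4 * A.card := by
  rw [mul_comm]
  exact Finset.card_biUnion_le_card_mul _ _ _ fun _ _ => Finset.card_le_four

/-- The loss 4|N| - |spread N| is monotone in N, since each further element adds at most four to the
spread. -/
theorem card_spread_le_of_subset {A N : Finset (ZMod m)} (h : N ⊆ A) :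
    (spread A).card + 4 * N.card ≤ (spread N).card + 4 * A.card := by
  have h1 : spread A ⊆ spread N ∪ spread (A \ N) := by
    rw [spread, spread, spread, ← Finset.union_biUnion, Finset.union_sdiff_of_subset h]
  have h2 := (Finset.card_le_card h1).trans (Finset.card_union_le _ _)
  have h3 := card_spread_le (A \ N)
  have h4 := Finset.card_sdiff_add_card_eq_card h
  omega

theorem intCast_injOn_of_sub_lt (c : ZMod m) {M : Finset ℤ} (hM : ∀ x ∈ M, ∀ y ∈ M, x - y < m) :
    Set.InjOn (fun x : ℤ => (x : ZMod m) + c) M := by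
  intro x hx y hy hxy
  have h1 : (x : ZMod m) = y := add_right_cancel hxy
  have h2 := (ZMod.intCast_eq_intCast_iff_dvd_sub _ _ _).1 h1
  have h3 := hM x hx y hy
  have h4 := hM y hy x hx
  have := Int.eq_zero_of_abs_lt_dvd h2 (abs_lt.2 ⟨by omega, by omega⟩)
  omega

/-- Overlaps of integers representing elements of `A` are overlaps of `A`. -/
theorem four_mul_card_le_of_card_spread {A : Finset (ZMod m)} {ℓ : ℕ}
    (hA : 4 * A.card ≤ (spread A).card + ℓ) (c : ZMod m) {M : Finset ℤ}
    (hMA : ∀ x ∈ M, (x : ZMod m) + c ∈ A) (hM : ∀ x ∈ M, ∀ y ∈ M, x - y < m) :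
    4 * M.card ≤ (intSpread M).card + ℓ := by
  set N : Finset (ZMod m) := M.image fun x : ℤ => (x : ZMod m) + c with hN
  have hcard : N.card = M.card := Finset.card_image_of_injOn (intCast_injOn_of_sub_lt c hM)
  have hNA : N ⊆ A := by
    intro z hz
    obtain ⟨x, hx, rfl⟩ := Finset.mem_image.1 hz
    exact hMA x hx
  have hsub : spread N ⊆ (intSpread M).image fun x : ℤ => (x : ZMod m) + c := by
    intro z hz
    simp only [spread, Finset.mem_biUnion, hN, Finset.mem_image, Finset.mem_insert,
      Finset.mem_singleton, intSpread] at hz ⊢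
    obtain ⟨_, ⟨x, hx, rfl⟩, rfl | rfl | rfl | rfl⟩ := hz
    · exact ⟨x, ⟨x, hx, by simp⟩, rfl⟩
    · exact ⟨x + 1, ⟨x, hx, by simp⟩, by push_cast; ring⟩
    · exact ⟨x + 3, ⟨x, hx, by simp⟩, by push_cast; ring⟩
    · exact ⟨x + 7, ⟨x, hx, by simp⟩, by push_cast; ring⟩
  have h1 := (Finset.card_le_card hsub).trans Finset.card_image_le
  have h2 := card_spread_le_of_subset hNA
  omega

theorem count_natCast_mem [NeZero m] (A : Finset (ZMod m)) :
    Nat.count (fun i : ℕ => (i : ZMod m) ∈ A) m = A.card := by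
  rw [Nat.count_eq_card_filter_range]
  refine Finset.card_nbij' (fun i => (i : ZMod m)) ZMod.val ?_ ?_ ?_ ?_
  · intro i hi
    exact (Finset.mem_filter.1 hi).2
  · intro x hx
    have hx' : x ∈ A := hx
    simp [ZMod.val_lt, hx']
  · intro i hi
    exact ZMod.val_cast_of_lt (Finset.mem_range.1 (Finset.mem_filter.1 hi).1)
  · intro x _
    exact ZMod.natCast_zmod_val x

theorem count_natCast_mem_add [NeZero m] (A : Finset (ZMod m)) (n : ℕ) :
    Nat.count (fun i : ℕ => (i : ZMod m) ∈ A) (m + n) =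
      A.card + Nat.count (fun i : ℕ => (i : ZMod m) ∈ A) n := by
  rw [Nat.count_add, count_natCast_mem]
  simp

/-- Cycle lemma: the weights 4 and -1 have positive sum 5|A| - m over a period, so starting at the
last minimum of the partial sums `G` makes all later ones positive. -/
theorem exists_positiveWalk [NeZero m] (A : Finset (ZMod m)) {ℓ : ℕ} (hcard : m < 5 * A.card)
    (hloss : 4 * A.card ≤ (spread A).card + ℓ) :
    ∃ (t : ZMod m) (f : ℤ → ℤ), PositiveWalk m ℓ (fun x => (x : ZMod m) + t ∈ A) f := by
  set G : ℕ → ℤ := fun n => 5 * (Nat.count (fun i : ℕ => (i : ZMod m) ∈ A) n : ℤ) - n with hG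
  have hper : ∀ n, G (m + n) = G n + (5 * A.card - m) := by
    intro n
    simp only [hG, count_natCast_mem_add]
    push_cast
    ring
  have hm : 0 < m := Nat.pos_of_ne_zero (NeZero.ne m)
  -- Scaling `G` by m and subtracting n breaks ties, so that t is the last of the minima in the
  -- period.
  obtain ⟨t, ht, hmin⟩ := Finset.exists_min_image (Finset.range m) (fun n => (m : ℤ) * G n - n)
    ⟨0, Finset.mem_range.2 hm⟩
  rw [Finset.mem_range] at ht
  have hpos : ∀ n, t < n → n ≤ t + m → G t < G n := by
    intro n hn hn'
    have hmpos : (0 : ℤ) < m := by exact_mod_cast hm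
    rcases lt_or_ge n m with h | h
    · have h1 := hmin n (Finset.mem_range.2 h)
      have h2 : (0 : ℤ) < m * (G n - G t) := by rw [mul_sub]; omega
      have := pos_of_mul_pos_right h2 hmpos.le
      omega
    · obtain ⟨k, rfl⟩ := Nat.exists_eq_add_of_le h
      have h1 := hmin k (Finset.mem_range.2 (by omega))
      have h2 : (0 : ℤ) < m * (G k - G t + 1) := by rw [mul_add, mul_sub]; omega
      have h3 := pos_of_mul_pos_right h2 hmpos.le
      rw [hper]
      omega
  have hstep : ∀ x : ℤ, 0 ≤ x → G (x + 1 + t).toNat =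
      G (x + t).toNat + if (x : ZMod m) + t ∈ A then 4 else -1 := by
    intro x hx
    obtain ⟨k, hk⟩ : ∃ k : ℕ, x + t = k := ⟨(x + t).toNat, by omega⟩
    rw [show (x + 1 + t).toNat = k + 1 by omega, show (x + t).toNat = k by omega]
    have hcast : (x : ZMod m) + t = (k : ZMod m) := by exact_mod_cast congrArg (Int.cast : ℤ → ZMod m) hk
    simp only [hG, Nat.count_succ, hcast]
    split_ifs <;> push_cast <;> ring
  refine ⟨t, fun x => G (x + t).toNat - G t, ?_, ?_, ?_, ?_, ?_, ?_⟩
  · intro x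
    simp
  · simp
  · intro x hx h
    simp only [hstep x hx, if_pos h]
    ring
  · intro x hx h
    simp only [hstep x hx, if_neg h]
    ring
  · intro j hj hj'
    have := hpos (j + t).toNat (by omega) (by omega)
    omega
  · intro M hM hspan
    exact four_mul_card_le_of_card_spread hloss (t : ZMod m) hM hspan

theorem Unreached.notMem_and_mem_spread {A : Finset (ZMod m)} {t : ZMod m} {x : ℤ}
    (h : Unreached (fun x : ℤ => (x : ZMod m) + t ∈ A) x) :
    (x : ZMod m) + t ∉ A ∧ (x : ZMod m) + t ∈ spread A ∧ (x : ZMod m) + t + 1 ∈ spread A ∧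
      (x : ZMod m) + t + 3 ∈ spread A ∧ (x : ZMod m) + t + 7 ∈ spread A := by
  obtain ⟨hx, h⟩ := h
  have key : ∀ s ∈ ({0, 1, 3, 7} : Finset ℤ), (x : ZMod m) + t + (s : ℤ) ∈ spread A := by
    intro s hs
    obtain ⟨a, ha, r, hr, hxs⟩ := h s hs
    have hcast : (x : ZMod m) + t + (s : ℤ) = (a : ZMod m) + t + (r : ℤ) := by
      have := congrArg (Int.cast : ℤ → ZMod m) hxs
      push_cast at this
      rw [add_right_comm, this]; ring
    rw [hcast]
    simp only [Finset.mem_insert, Finset.mem_singleton] at hr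
    exact Finset.mem_biUnion.2 ⟨_, ha, by rcases hr with rfl | rfl | rfl | rfl <;> simp⟩
  refine ⟨hx, ?_, ?_, ?_, ?_⟩
  · simpa using key 0 (by simp)
  · simpa using key 1 (by simp)
  · simpa using key 3 (by simp)
  · simpa using key 7 (by simp)

end Spread

/-! ### Excluding |A| = q + 1 by unreached vertices. -/

section LowerBounds

variable {m : ℕ}

/-- Domination of a left vertex by the left vertices `A` and the right vertices `B`. -/
def LeftDominated (A B : Finset (ZMod m)) (x : ZMod m) : Prop :=
  x ∈ A ∨ x ∈ B ∨ x + 1 ∈ B ∨ x + 3 ∈ B ∨ x + 7 ∈ B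

/-- Domination of a right vertex by the left vertices `A` and the right vertices `B`. -/
def RightDominated (A B : Finset (ZMod m)) (x : ZMod m) : Prop :=
  x ∈ B ∨ x ∈ spread A

/-- The image of a set of vertices under the reflection that swaps the two sides. -/
def reflect (A : Finset (ZMod m)) : Finset (ZMod m) :=
  A.map (Equiv.neg _).toEmbedding

theorem mem_reflect {A : Finset (ZMod m)} {x : ZMod m} : x ∈ reflect A ↔ -x ∈ A := by
  simp [reflect, Finset.mem_map_equiv]

theorem card_reflect (A : Finset (ZMod m)) : (reflect A).card = A.card :=
  Finset.card_map _

theorem rightDominated_reflect {A B : Finset (ZMod m)} {x : ZMod m} :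
    RightDominated (reflect B) (reflect A) x ↔ LeftDominated A B (-x) := by
  simp only [RightDominated, LeftDominated, mem_spread, mem_reflect]
  rw [show -(x - 1) = -x + 1 by ring, show -(x - 3) = -x + 3 by ring,
    show -(x - 7) = -x + 7 by ring]

theorem leftDominated_reflect {A B : Finset (ZMod m)} {x : ZMod m} :
    LeftDominated (reflect B) (reflect A) x ↔ RightDominated A B (-x) := by
  simp only [RightDominated, LeftDominated, mem_spread, mem_reflect]
  rw [show -(x + 1) = -x - 1 by ring, show -(x + 3) = -x - 3 by ring,
    show -(x + 7) = -x - 7 by ring]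

/-- Inclusion and exclusion. With |spread A| equal to 4|A| minus the loss, this bounds the loss and
|B ∩ spread A| together. -/
theorem card_inter_spread_add_le [NeZero m] {A B H : Finset (ZMod m)}
    (h : ∀ x, x ∉ H → RightDominated A B x) :
    (B ∩ spread A).card + m ≤ B.card + (spread A).card + H.card := by
  have h1 : (Finset.univ : Finset (ZMod m)) ⊆ (B ∪ spread A) ∪ H := by
    intro x _
    by_cases hx : x ∈ H
    · simp [hx]
    · rcases h x hx with h | h <;> simp [h]
  have h2 := (Finset.card_le_card h1).trans (Finset.card_union_le _ _)
  rw [Finset.card_univ, ZMod.card] at h2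
  have h3 := Finset.card_union_add_card_inter B (spread A)
  omega

theorem card_add_le_of_left [NeZero m] {A B H : Finset (ZMod m)}
    (h : ∀ x, x ∉ H → LeftDominated A B x) : m ≤ A.card + 4 * B.card + H.card := by
  have h1 := card_inter_spread_add_le (A := reflect B) (B := reflect A) (H := reflect H)
    fun x hx => rightDominated_reflect.2 (h _ (by rwa [mem_reflect] at hx))
  have h2 := card_spread_le (reflect B)
  simp only [card_reflect] at h1 h2
  omega

theorem card_add_le_of_right [NeZero m] {A B H : Finset (ZMod m)}
    (h : ∀ x, x ∉ H → RightDominated A B x) : m ≤ B.card + 4 * A.card + H.card := by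
  have h1 := card_inter_spread_add_le h
  have h2 := card_spread_le A
  omega

theorem not_positiveWalk_zero {m : ℤ} {α : ℤ → Prop} {f : ℤ → ℤ} (hm : 8 ≤ m) :
    ¬ PositiveWalk m 0 α f := by
  intro W
  have h0 := W.mem_zero (by omega)
  obtain ⟨g, hg, hg', h, -, -⟩ := W.next h0 W.zero
  interval_cases g
  · exact W.not_loss {0, 1} 8 hm (by simpa using ⟨h0, h⟩)
  · exact W.not_loss {0, 2} 8 hm (by simpa using ⟨h0, h⟩)
  · exact W.not_loss {0, 3} 8 hm (by simpa using ⟨h0, h⟩)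
  · exact W.not_loss {0, 4} 8 hm (by simpa using ⟨h0, h⟩)

/-- More than m/5 elements produce a gap of at most 4 on the cycle, and every such gap is an
overlap. -/
theorem card_spread_lt [NeZero m] {A : Finset (ZMod m)} (hm : 8 ≤ m) (hA : m < 5 * A.card) :
    (spread A).card < 4 * A.card := by
  refine lt_of_le_of_ne (card_spread_le A) fun h => ?_
  obtain ⟨t, f, W⟩ := exists_positiveWalk A (ℓ := 0) hA (by omega)
  exact not_positiveWalk_zero (by exact_mod_cast hm) W

/-- A dominated left vertex that is unreached is dominated by an element of `B ∩ spread A`. -/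
theorem Unreached.exists_mem_inter {A B : Finset (ZMod m)} {t : ZMod m} {x : ℤ}
    (h : Unreached (fun x : ℤ => (x : ZMod m) + t ∈ A) x)
    (hdom : LeftDominated A B ((x : ZMod m) + t)) :
    ∃ y : ℤ, (y = x ∨ y = x + 1 ∨ y = x + 3 ∨ y = x + 7) ∧ (y : ZMod m) + t ∈ B ∩ spread A := by
  obtain ⟨h0, h1, h2, h3, h4⟩ := h.notMem_and_mem_spread
  simp only [Finset.mem_inter]
  rcases hdom with h | h | h | h | h
  · exact absurd h h0
  · exact ⟨x, by simp, h, h1⟩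
  · have e : ((x + 1 : ℤ) : ZMod m) + t = x + t + 1 := by push_cast; ring
    exact ⟨x + 1, by simp, e ▸ h, e ▸ h2⟩
  · have e : ((x + 3 : ℤ) : ZMod m) + t = x + t + 3 := by push_cast; ring
    exact ⟨x + 3, by simp, e ▸ h, e ▸ h3⟩
  · have e : ((x + 7 : ℤ) : ZMod m) + t = x + t + 7 := by push_cast; ring
    exact ⟨x + 7, by simp, e ▸ h, e ▸ h4⟩

theorem intCast_add_inj {t : ZMod m} {x y : ℤ} (h : (x : ZMod m) + t = y + t)
    (h1 : x - y < m) (h2 : y - x < m) : x = y := by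
  have h3 := (ZMod.intCast_eq_intCast_iff_dvd_sub _ _ _).1 (add_right_cancel h)
  have := Int.eq_zero_of_abs_lt_dvd h3 (abs_lt.2 ⟨by omega, by omega⟩)
  omega

/-- Two far apart unreached vertices are not dominated by the same element of `B ∩ spread A`. -/
theorem Unreached.not_both {A B : Finset (ZMod m)} {t : ZMod m} {x y : ℤ}
    (hx : Unreached (fun x : ℤ => (x : ZMod m) + t ∈ A) x)
    (hy : Unreached (fun x : ℤ => (x : ZMod m) + t ∈ A) y)
    (hcard : (B ∩ spread A).card ≤ 1)
    (hdx : LeftDominated A B ((x : ZMod m) + t)) (hdy : LeftDominated A B ((y : ZMod m) + t))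
    (hxy : y - x = 5 ∨ 8 ≤ y - x) (hm : y - x + 7 < m) (hm' : 14 ≤ m) : False := by
  obtain ⟨a, ha, ha'⟩ := hx.exists_mem_inter hdx
  obtain ⟨b, hb, hb'⟩ := hy.exists_mem_inter hdy
  have := intCast_add_inj (Finset.card_le_one.1 hcard _ ha' _ hb') (by omega) (by omega)
  omega

theorem Unreached.false_of_card_inter {A B : Finset (ZMod m)} {t : ZMod m} {x : ℤ}
    (hx : Unreached (fun x : ℤ => (x : ZMod m) + t ∈ A) x)
    (hcard : (B ∩ spread A).card = 0) (hdx : LeftDominated A B ((x : ZMod m) + t)) : False := by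
  obtain ⟨a, -, ha'⟩ := hx.exists_mem_inter hdx
  rw [Finset.card_eq_zero.1 hcard] at ha'
  exact Finset.notMem_empty _ ha'

/-- The loss and |B ∩ spread A| add up to at most 2, and the loss is at least 1. With loss 1, a
single element of B would have to serve two unreached vertices at distance 5, which have no common
neighbour; with loss 2, one unreached vertex is enough. -/
theorem not_dominated_four [NeZero m] {q : ℕ} (hm : m = 5 * q + 4) (hq : 3 ≤ q)
    {A B : Finset (ZMod m)} (hA : A.card = q + 1) (hB : B.card ≤ q + 2)
    (hR : ∀ x, RightDominated A B x) (hL : ∀ x, LeftDominated A B x) : False := by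
  have hmZ : (m : ℤ) = 5 * (q : ℤ) + 4 := by exact_mod_cast hm
  have h1 := card_inter_spread_add_le (H := ∅) fun x _ => hR x
  have h2 := card_spread_lt (A := A) (by omega) (by omega)
  rw [Finset.card_empty] at h1
  by_cases h3 : 4 * A.card ≤ (spread A).card + 1
  · obtain ⟨t, f, W⟩ := exists_positiveWalk A (by omega) h3
    obtain ⟨c, hc, hc'⟩ := W.exists_unreached_of_one_overlap_four hmZ (by omega)
    exact hc.not_both hc' (by omega) (hL _) (hL _) (by omega) (by omega) (by omega)
  · obtain ⟨t, f, W⟩ := exists_positiveWalk A (ℓ := 2) (by omega) (by omega)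
    exact W.exists_unreached_of_two_overlaps hmZ (by omega) fun x hx =>
      hx.false_of_card_inter (B := B) (by omega) (hL _)

theorem not_dominated_fourteen {A B : Finset (ZMod 14)} (hA : A.card = 3) (hB : B.card ≤ 3)
    (hR : ∀ x, RightDominated A B x) (z : ZMod 14) (hL : ∀ x, x ≠ z → LeftDominated A B x) :
    False := by
  have h1 := card_inter_spread_add_le (H := ∅) fun x _ => hR x
  have h2 := card_spread_lt (A := A) (by omega) (by omega)
  rw [Finset.card_empty] at h1
  obtain ⟨t, f, W⟩ := exists_positiveWalk A (ℓ := 1) (by omega) (by omega)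
  obtain ⟨c, hc, hc'⟩ := W.exists_unreached_of_one_overlap_four (q := 2) (by norm_num) (by norm_num)
  have key : ∀ x : ℤ, Unreached (fun x : ℤ => (x : ZMod 14) + t ∈ A) x → (x : ZMod 14) + t = z :=
    fun x hx => by_contra fun h => hx.false_of_card_inter (B := B) (by omega) (hL _ h)
  have := intCast_add_inj ((key _ hc).trans (key _ hc').symm) (by omega) (by omega)
  omega

theorem not_dominated_three [NeZero m] {q : ℕ} (hm : m = 5 * q + 3) (hq : 4 ≤ q)
    {A B : Finset (ZMod m)} (hA : A.card = q + 1) (hB : B.card ≤ q + 1)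
    (hR : ∀ x, RightDominated A B x) (z : ZMod m) (hL : ∀ x, x ≠ z → LeftDominated A B x) :
    False := by
  have hmZ : (m : ℤ) = 5 * (q : ℤ) + 3 := by exact_mod_cast hm
  have h1 := card_inter_spread_add_le (H := ∅) fun x _ => hR x
  have h2 := card_spread_lt (A := A) (by omega) (by omega)
  rw [Finset.card_empty] at h1
  by_cases h3 : 4 * A.card ≤ (spread A).card + 1
  · obtain ⟨t, f, W⟩ := exists_positiveWalk A (by omega) h3
    obtain ⟨c, h4, h5, h6, h7⟩ := W.exists_unreached_of_one_overlap_three hmZ (by omega)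
    -- The pairs {c + 1, c + 6} and {c - 3, c + 7}, at distances 5 and 10, each need two elements of
    -- B inside the spread. The exempt vertex z can relieve only one of these disjoint pairs.
    have key1 : ((c + 1 : ℤ) : ZMod m) + t = z ∨ ((c + 6 : ℤ) : ZMod m) + t = z := by
      by_contra! h
      exact h5.not_both h6 (by omega) (hL _ h.1) (hL _ h.2) (by omega) (by omega) (by omega)
    have key2 : ((c - 3 : ℤ) : ZMod m) + t = z ∨ ((c + 7 : ℤ) : ZMod m) + t = z := by
      by_contra! h
      exact h4.not_both h7 (by omega) (hL _ h.1) (hL _ h.2) (by omega) (by omega) (by omega)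
    rcases key1 with h8 | h8 <;> rcases key2 with h9 | h9 <;>
    · have := intCast_add_inj (h8.trans h9.symm) (by omega) (by omega)
      omega
  · obtain ⟨t, f, W⟩ := exists_positiveWalk A (ℓ := 2) (by omega) (by omega)
    have key : ∀ x : ℤ, Unreached (fun x : ℤ => (x : ZMod m) + t ∈ A) x → (x : ZMod m) + t = z :=
      fun x hx => by_contra fun h => hx.false_of_card_inter (B := B) (by omega) (hL _ h)
    refine W.exists_two_unreached_of_two_overlaps hmZ (by omega) fun x y hx hy h h' => ?_
    have := intCast_add_inj ((key _ hx).trans (key _ hy).symm) (by omega) (by omega)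
    omega

end LowerBounds

/-! ### Excluding |A| = q by packings without overlap. -/

section NoOverlap

variable {m : ℕ}

/-- The translates of `{0, 1, 3, 7}` by elements of `A` are pairwise disjoint. -/
def NoOverlap (A : Finset (ZMod m)) : Prop :=
  ∀ a ∈ A, ∀ d ∈ ({1, 2, 3, 4, 6, 7} : Finset ℤ), a + (d : ZMod m) ∉ A

theorem noOverlap_of_card_spread (hm : 8 ≤ m) {A : Finset (ZMod m)}
    (hA : 4 * A.card ≤ (spread A).card) : NoOverlap A := by
  intro a ha d hd had
  have key := four_mul_card_le_of_card_spread (ℓ := 0) hA a (M := {0, d})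
    (by simpa [ha, add_comm] using had)
  simp only [Finset.mem_insert, Finset.mem_singleton] at hd
  rcases hd with rfl | rfl | rfl | rfl | rfl | rfl <;>
  · have := key (by simp; omega)
    revert this
    decide

theorem NoOverlap.sub_notMem {A : Finset (ZMod m)} (h : NoOverlap A) {a b : ZMod m} (ha : a ∈ A)
    (hb : b ∈ A) : a - b ≠ 1 ∧ a - b ≠ 2 ∧ a - b ≠ 3 ∧ a - b ≠ 4 ∧ a - b ≠ 6 ∧ a - b ≠ 7 := by
  refine ⟨?_, ?_, ?_, ?_, ?_, ?_⟩ <;> intro hab <;> rw [sub_eq_iff_eq_add'] at hab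
  · exact h b hb 1 (by simp) (by simpa [hab] using ha)
  · exact h b hb 2 (by simp) (by simpa [hab] using ha)
  · exact h b hb 3 (by simp) (by simpa [hab] using ha)
  · exact h b hb 4 (by simp) (by simpa [hab] using ha)
  · exact h b hb 6 (by simp) (by simpa [hab] using ha)
  · exact h b hb 7 (by simp) (by simpa [hab] using ha)

/-- The elements not covered by the intervals `{a, …, a + 4}` for `a ∈ A`. -/
def windowFree [NeZero m] (A : Finset (ZMod m)) : Finset (ZMod m) :=
  (A.biUnion fun a => {a, a + 1, a + 2, a + 3, a + 4})ᶜ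

theorem mem_windowFree [NeZero m] {A : Finset (ZMod m)} {x : ZMod m} :
    x ∈ windowFree A ↔ x ∉ A ∧ x - 1 ∉ A ∧ x - 2 ∉ A ∧ x - 3 ∉ A ∧ x - 4 ∉ A := by
  simp only [windowFree, Finset.mem_compl, Finset.mem_biUnion, Finset.mem_insert,
    Finset.mem_singleton, not_exists, not_and, not_or]
  constructor
  · intro h
    exact ⟨fun hx => (h _ hx).1 rfl, fun hx => (h _ hx).2.1 (by ring),
      fun hx => (h _ hx).2.2.1 (by ring), fun hx => (h _ hx).2.2.2.1 (by ring),
      fun hx => (h _ hx).2.2.2.2 (by ring)⟩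
  · rintro ⟨h0, h1, h2, h3, h4⟩ a ha
    refine ⟨?_, ?_, ?_, ?_, ?_⟩ <;> rintro rfl
    · exact h0 ha
    · exact h1 (by simpa using ha)
    · exact h2 (by simpa using ha)
    · exact h3 (by simpa using ha)
    · exact h4 (by simpa using ha)

/-- The distances 1, 2, 3, 4 are excluded, so the windows of length five are disjoint. -/
theorem NoOverlap.card_windowFree [NeZero m] (hm : 8 ≤ m) {A : Finset (ZMod m)}
    (h : NoOverlap A) : (windowFree A).card + 5 * A.card = m := by
  have hinj : Function.Injective (fun i : Fin 5 => ((i : ℕ) : ZMod m)) := by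
    intro i j hij
    have := (ZMod.natCast_eq_natCast_iff' _ _ _).1 hij
    rw [Nat.mod_eq_of_lt (by omega), Nat.mod_eq_of_lt (by omega)] at this
    exact Fin.ext this
  have hW : ∀ a : ZMod m, ({a, a + 1, a + 2, a + 3, a + 4} : Finset (ZMod m)) =
      Finset.univ.image fun i : Fin 5 => a + ((i : ℕ) : ZMod m) := by
    intro a
    ext x
    simp [Fin.exists_fin_succ, eq_comm (a := x), show (1 : ZMod m) + 1 = 2 by norm_num,
      show (2 : ZMod m) + 1 = 3 by norm_num, show (3 : ZMod m) + 1 = 4 by norm_num]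
  have hdisj : (A : Set (ZMod m)).PairwiseDisjoint
      fun a => ({a, a + 1, a + 2, a + 3, a + 4} : Finset (ZMod m)) := by
    intro a ha b hb hab
    rw [Function.onFun, Finset.disjoint_left]
    intro x hxa hxb
    simp only [hW, Finset.mem_image, Finset.mem_univ, true_and] at hxa hxb
    obtain ⟨i, rfl⟩ := hxa
    obtain ⟨j, hij⟩ := hxb
    obtain ⟨h1, h2, h3, h4, -⟩ := h.sub_notMem ha hb
    obtain ⟨h1', h2', h3', h4', -⟩ := h.sub_notMem hb ha
    have e1 : a - b = ((j : ℕ) : ZMod m) - ((i : ℕ) : ZMod m) := by linear_combination -hij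
    have e2 : b - a = ((i : ℕ) : ZMod m) - ((j : ℕ) : ZMod m) := by linear_combination hij
    rcases le_total (i : ℕ) (j : ℕ) with hle | hle
    · rw [← Nat.cast_sub hle] at e1
      rw [e1] at h1 h2 h3 h4
      have : (j : ℕ) - i ≤ 4 := by omega
      interval_cases hk : (j : ℕ) - (i : ℕ)
      · exact hab (sub_eq_zero.1 (by simpa using e1))
      all_goals simp at h1 h2 h3 h4
    · rw [← Nat.cast_sub hle] at e2
      rw [e2] at h1' h2' h3' h4'
      have : (i : ℕ) - j ≤ 4 := by omega
      interval_cases hk : (i : ℕ) - (j : ℕ)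
      · exact hab (sub_eq_zero.1 (by simpa using e2)).symm
      all_goals simp at h1' h2' h3' h4'
  have hcard : (A.biUnion fun a => ({a, a + 1, a + 2, a + 3, a + 4} : Finset (ZMod m))).card =
      5 * A.card := by
    rw [Finset.card_biUnion hdisj, Finset.sum_const_nat (m := 5), mul_comm]
    intro a _
    rw [hW, Finset.card_image_of_injective _ fun i j hij => hinj (add_left_cancel hij)]
    simp
  rw [windowFree, ← hcard, Finset.card_compl_add_card, ZMod.card]

/-- Uncovered elements come in runs of at least three. -/
theorem NoOverlap.exists_run [NeZero m] {A : Finset (ZMod m)} (h : NoOverlap A)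
    (hA : A.Nonempty) (hZ : (windowFree A).Nonempty) :
    ∃ x, x ∈ windowFree A ∧ x + 1 ∈ windowFree A ∧ x + 2 ∈ windowFree A := by
  -- Take x at the start of a run: then x - 5 lies in A, and the excluded distances 6 and 7 keep x +
  -- 1 and x + 2 uncovered.
  obtain ⟨x, hx, hx'⟩ : ∃ x ∈ windowFree A, x - 1 ∉ windowFree A := by
    by_contra! hcon
    obtain ⟨z, hz⟩ := hZ
    obtain ⟨a, ha⟩ := hA
    have key : ∀ n : ℕ, z - n ∈ windowFree A := by
      intro n
      induction n with
      | zero => simpa using hz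
      | succ n ih => simpa [sub_sub] using hcon _ ih
    have := key (z - a).val
    rw [ZMod.natCast_zmod_val, sub_sub_cancel, mem_windowFree] at this
    exact this.1 ha
  rw [mem_windowFree] at hx
  obtain ⟨h0, h1, h2, h3, h4⟩ := hx
  have h5 : x - 5 ∈ A := by
    by_contra h5
    refine hx' (mem_windowFree.2 ⟨h1, ?_, ?_, ?_, ?_⟩)
    · rwa [show x - 1 - 1 = x - 2 by ring]
    · rwa [show x - 1 - 2 = x - 3 by ring]
    · rwa [show x - 1 - 3 = x - 4 by ring]
    · rwa [show x - 1 - 4 = x - 5 by ring]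
  have h6 : x + 1 ∉ A := fun h6 => (h.sub_notMem h6 h5).2.2.2.2.1 (by ring)
  have h7 : x + 2 ∉ A := fun h7 => (h.sub_notMem h7 h5).2.2.2.2.2 (by ring)
  refine ⟨x, mem_windowFree.2 ⟨h0, h1, h2, h3, h4⟩, mem_windowFree.2 ⟨h6, ?_, ?_, ?_, ?_⟩,
    mem_windowFree.2 ⟨h7, ?_, ?_, ?_, ?_⟩⟩
  · rwa [show x + 1 - 1 = x by ring]
  · rwa [show x + 1 - 2 = x - 1 by ring]
  · rwa [show x + 1 - 3 = x - 2 by ring]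
  · rwa [show x + 1 - 4 = x - 3 by ring]
  · rwa [show x + 2 - 1 = x + 1 by ring]
  · rwa [show x + 2 - 2 = x by ring]
  · rwa [show x + 2 - 3 = x - 1 by ring]
  · rwa [show x + 2 - 4 = x - 2 by ring]

theorem card_run (hm : 8 ≤ m) (x : ZMod m) : ({x, x + 1, x + 2} : Finset (ZMod m)).card = 3 := by
  have key : ∀ k : ℕ, 0 < k → k < 8 → (k : ZMod m) ≠ 0 := fun k hk hk' h =>
    absurd (Nat.le_of_dvd hk ((ZMod.natCast_eq_zero_iff _ _).1 h)) (by omega)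
  have h1 : (1 : ZMod m) ≠ 0 := by simpa using key 1 (by norm_num) (by norm_num)
  have h2 : (2 : ZMod m) ≠ 0 := by simpa using key 2 (by norm_num) (by norm_num)
  refine Finset.card_eq_three.2 ⟨x, x + 1, x + 2, ?_, ?_, ?_, rfl⟩
  · simpa using h1
  · simpa using h2
  · intro h
    exact h1 (by linear_combination -h)

/-- A packing of `q` translates of `{0, 1, 3, 7}` does not fit into a cycle of length `5 * q + 1` or
`5 * q + 2`. -/
theorem card_spread_lt_of_period [NeZero m] {q : ℕ} (hq : 2 ≤ q) (hm : m = 5 * q + 1 ∨ m = 5 * q + 2)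
    {A : Finset (ZMod m)} (hA : A.card = q) : (spread A).card < 4 * q := by
  by_contra! hs
  have hm8 : 8 ≤ m := by omega
  have hN := noOverlap_of_card_spread hm8 (A := A) (by omega)
  have h1 := hN.card_windowFree hm8
  obtain ⟨x, h2, h3, h4⟩ := hN.exists_run (Finset.card_pos.1 (by omega))
    (Finset.card_pos.1 (by omega))
  have h5 : ({x, x + 1, x + 2} : Finset (ZMod m)) ⊆ windowFree A := by
    simp [Finset.insert_subset_iff, h2, h3, h4]
  have := Finset.card_le_card h5
  rw [card_run hm8] at this
  omega

/-- A packing of `q` translates of `{0, 1, 3, 7}` in a cycle of length `5 * q + 3` is an arithmetic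
progression. -/
theorem NoOverlap.exists_progression [NeZero m] {q : ℕ} (hq : 1 ≤ q) (hm : m = 5 * q + 3)
    {A : Finset (ZMod m)} (hA : A.card = q) (hN : NoOverlap A) :
    ∃ t : ZMod m, ∀ k : ℕ, k < q → t + (5 * k : ℕ) ∈ A := by
  have hm8 : 8 ≤ m := by omega
  have h1 := hN.card_windowFree hm8
  obtain ⟨x, h2, h3, h4⟩ := hN.exists_run (Finset.card_pos.1 (by omega))
    (Finset.card_pos.1 (by omega))
  have h5 : ({x, x + 1, x + 2} : Finset (ZMod m)) ⊆ windowFree A := by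
    simp [Finset.insert_subset_iff, h2, h3, h4]
  have h6 : ({x, x + 1, x + 2} : Finset (ZMod m)) = windowFree A :=
    -- Only m - 5q = 3 elements are uncovered, so this run is all of them and the windows tile the
    -- rest.
    Finset.eq_of_subset_of_card_le h5 (by rw [card_run hm8]; omega)
  have hcov : ∀ k : ℕ, k < 5 * q → x + 3 + (k : ℕ) ∉ windowFree A := by
    intro k hk hmem
    have hne : ∀ j : ℕ, 0 < j → j < m → (j : ZMod m) ≠ 0 := fun j hj hj' h =>
      absurd (Nat.le_of_dvd hj ((ZMod.natCast_eq_zero_iff _ _).1 h)) (by omega)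
    rw [← h6] at hmem
    simp only [Finset.mem_insert, Finset.mem_singleton] at hmem
    rcases hmem with h | h | h
    · exact hne (k + 3) (by omega) (by omega) (by push_cast; linear_combination h)
    · exact hne (k + 2) (by omega) (by omega) (by push_cast; linear_combination h)
    · exact hne (k + 1) (by omega) (by omega) (by push_cast; linear_combination h)
  have hfirst : x + 3 ∈ A := by
    by_contra h
    have := hcov 0 (by omega)
    rw [mem_windowFree] at this h4
    apply this
    simp only [Nat.cast_zero, add_zero]
    refine ⟨h, ?_, ?_, ?_, ?_⟩
    · rw [show x + 3 - 1 = x + 2 by ring]; exact h4.1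
    · rw [show x + 3 - 2 = x + 2 - 1 by ring]; exact h4.2.1
    · rw [show x + 3 - 3 = x + 2 - 2 by ring]; exact h4.2.2.1
    · rw [show x + 3 - 4 = x + 2 - 3 by ring]; exact h4.2.2.2.1
  refine ⟨x + 3, fun k => ?_⟩
  induction k with
  | zero => intro _; simpa using hfirst
  | succ k ih =>
    intro hk
    have ha := ih (by omega)
    by_contra h
    refine hcov (5 * (k + 1)) (by omega) (mem_windowFree.2 ⟨h, ?_, ?_, ?_, ?_⟩) <;> intro h'
    · exact (hN.sub_notMem h' ha).2.2.2.1 (by push_cast; ring)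
    · exact (hN.sub_notMem h' ha).2.2.1 (by push_cast; ring)
    · exact (hN.sub_notMem h' ha).2.1 (by push_cast; ring)
    · exact (hN.sub_notMem h' ha).1 (by push_cast; ring)

/-- All counts are tight: the translates are disjoint, B avoids `spread A`, and the exempt vertex w
lies in neither. As A is a progression, each possible w can be matched with a left vertex outside A
whose neighbours all lie in `spread A` or equal w, so that it is undominated. -/
theorem not_dominated_three_of_card_eq [NeZero m] {q : ℕ} (hm : m = 5 * q + 3) (hq : 3 ≤ q)
    {A B : Finset (ZMod m)} (hA : A.card = q) (hB : B.card ≤ q + 2)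
    (w : ZMod m) (hR : ∀ x, x ≠ w → RightDominated A B x) (hL : ∀ x, LeftDominated A B x) :
    False := by
  have h1 := card_inter_spread_add_le (H := {w}) fun x hx => hR x (by simpa using hx)
  have h2 := card_spread_le A
  rw [Finset.card_singleton] at h1
  have hN := noOverlap_of_card_spread (by omega) (A := A) (by omega)
  have hBw : w ∉ B ∧ w ∉ spread A := by
    by_contra hcon
    have := card_add_le_of_right (A := A) (B := B) (H := ∅) fun x _ => by
      by_cases hx : x = w
      · subst hx
        unfold RightDominated
        tauto
      · exact hR x hx
    rw [Finset.card_empty] at this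
    omega
  have hdisj : ∀ y ∈ B, y ∉ spread A := by
    intro y hy hy'
    have : 0 < (B ∩ spread A).card := Finset.card_pos.2 ⟨y, Finset.mem_inter.2 ⟨hy, hy'⟩⟩
    omega
  have hbad : ∀ y, y ∈ spread A ∨ y = w → y ∉ B := by
    rintro y (hy | rfl) hyB
    · exact hdisj y hyB hy
    · exact hBw.1 hyB
  have key : ∀ x, x ∉ A → (x ∈ spread A ∨ x = w) → (x + 1 ∈ spread A ∨ x + 1 = w) →
      (x + 3 ∈ spread A ∨ x + 3 = w) → (x + 7 ∈ spread A ∨ x + 7 = w) → False := by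
    intro x hx h1 h2 h3 h4
    rcases hL x with h | h | h | h | h
    · exact hx h
    · exact hbad _ h1 h
    · exact hbad _ h2 h
    · exact hbad _ h3 h
    · exact hbad _ h4 h
  obtain ⟨t, ht⟩ := hN.exists_progression (by omega) hm hA
  have hm0 : (m : ZMod m) = 0 := ZMod.natCast_self m
  have hs : ∀ (x : ZMod m) (k s : ℕ), k < q → s = 0 ∨ s = 1 ∨ s = 3 ∨ s = 7 →
      x = t + ((5 * k + s : ℕ) : ZMod m) → x ∈ spread A := by
    rintro x k s hk hs rfl
    refine Finset.mem_biUnion.2 ⟨_, ht k hk, ?_⟩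
    rcases hs with rfl | rfl | rfl | rfl <;> simp [add_assoc]
  have hs' : ∀ (x : ZMod m) (n : ℕ), x = t + (n : ZMod m) →
      (∃ k, k < q ∧ (n = 5 * k ∨ n = 5 * k + 1 ∨ n = 5 * k + 3 ∨ n = 5 * k + 7 ∨ n = 5 * k + m ∨
        n = 5 * k + m + 1)) → x ∈ spread A := by
    rintro x n rfl ⟨k, hk, h⟩
    rcases h with rfl | rfl | rfl | rfl | rfl | rfl
    · exact hs _ k 0 hk (by simp) rfl
    · exact hs _ k 1 hk (by simp) rfl
    · exact hs _ k 3 hk (by simp) rfl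
    · exact hs _ k 7 hk (by simp) rfl
    · exact hs _ k 0 hk (by simp) (by push_cast; rw [hm0])
    · exact hs _ k 1 hk (by simp) (by push_cast; rw [hm0]; ring)
  obtain ⟨n, hn, rfl⟩ : ∃ n : ℕ, n < m ∧ w = t + (n : ZMod m) :=
    ⟨(w - t).val, ZMod.val_lt _, by rw [ZMod.natCast_zmod_val]; ring⟩
  have hw : ∀ k s, k < q → s = 0 ∨ s = 1 ∨ s = 3 ∨ s = 7 → n ≠ 5 * k + s := by
    rintro k s hk h rfl
    exact hBw.2 (hs _ k s hk h rfl)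
  -- These are the q + 3 positions, relative to t, outside the spread of 0, 5, …, 5(q - 1).
  have hcases : n = 2 ∨ n = 4 ∨ n = 5 * q ∨ n = 5 * q + 1 ∨
      ∃ k, n = 5 * k + 4 ∧ 1 ≤ k ∧ k < q := by
    have e0 := fun h => hw (n / 5) 0 h (by simp)
    have e1 := fun h => hw (n / 5) 1 h (by simp)
    have e3 := fun h => hw (n / 5) 3 h (by simp)
    have e7 := fun h => hw (n / 5 - 1) 7 h (by simp)
    by_cases h4 : n % 5 = 4 ∧ 1 ≤ n / 5 ∧ n / 5 < q
    · exact Or.inr (Or.inr (Or.inr (Or.inr ⟨n / 5, by omega, h4.2⟩)))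
    · have : n = 2 ∨ n = 4 ∨ n = 5 * q ∨ n = 5 * q + 1 := by omega
      rcases this with h | h | h | h <;> simp [h]
  have hnot : ∀ (x : ZMod m) (k d : ℕ), k < q → d = 1 ∨ d = 2 ∨ d = 3 ∨ d = 6 →
      x = t + ((5 * k + d : ℕ) : ZMod m) → x ∉ A := by
    rintro x k d hk hd rfl hx
    have h := hN.sub_notMem hx (ht k hk)
    rcases hd with rfl | rfl | rfl | rfl
    · exact h.1 (by push_cast; ring)
    · exact h.2.1 (by push_cast; ring)
    · exact h.2.2.1 (by push_cast; ring)
    · exact h.2.2.2.2.1 (by push_cast; ring)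
  have e : ∀ (a b c : ℕ), a + b = c → t + (a : ZMod m) + (b : ZMod m) = t + (c : ZMod m) := by
    rintro a b c rfl
    push_cast; ring
  -- The undominated left vertices are -1, 3, 5q - 3, 5q + 1 and 5k + 1 relative to t; they are
  -- adjacent to w through the shifts 3, 1, 3, 0 and 3.
  rcases hcases with rfl | rfl | rfl | rfl | ⟨k, rfl, hk, hk'⟩
  · refine key (t + (m - 1 : ℕ)) ?_ (Or.inl ?_) (Or.inl ?_) (Or.inr ?_) (Or.inl ?_)
    · intro h
      refine (hN.sub_notMem (ht 0 (by omega)) h).1 ?_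
      rw [Nat.cast_sub (by omega), hm0]; push_cast; ring
    · exact hs' _ _ rfl ⟨q - 1, by omega, by omega⟩
    · exact hs' _ m (by simpa using e (m - 1) 1 m (by omega)) ⟨0, by omega, by omega⟩
    · have := e (m - 1) 3 (m + 2) (by omega)
      push_cast at this
      rw [this, hm0]; push_cast; ring
    · exact hs' _ (m + 6) (by simpa using e (m - 1) 7 (m + 6) (by omega)) ⟨1, by omega, by omega⟩
  · refine key (t + (3 : ℕ)) (hnot _ 0 3 (by omega) (by simp) rfl) (Or.inl ?_) (Or.inr ?_)
      (Or.inl ?_) (Or.inl ?_)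
    · exact hs' _ _ rfl ⟨0, by omega, by omega⟩
    · simpa using e 3 1 4 rfl
    · exact hs' _ 6 (by simpa using e 3 3 6 rfl) ⟨1, by omega, by omega⟩
    · exact hs' _ 10 (by simpa using e 3 7 10 rfl) ⟨2, by omega, by omega⟩
  · refine key (t + (5 * q - 3 : ℕ)) (hnot _ (q - 1) 2 (by omega) (by simp)
      (by rw [show 5 * q - 3 = 5 * (q - 1) + 2 by omega])) (Or.inl ?_) (Or.inl ?_)
      (Or.inr ?_) (Or.inl ?_)
    · exact hs' _ _ rfl ⟨q - 2, by omega, by omega⟩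
    · exact hs' _ (5 * q - 2) (by simpa using e (5 * q - 3) 1 (5 * q - 2) (by omega))
        ⟨q - 1, by omega, by omega⟩
    · simpa using e (5 * q - 3) 3 (5 * q) (by omega)
    · exact hs' _ (5 * q + 4) (by simpa using e (5 * q - 3) 7 (5 * q + 4) (by omega))
        ⟨0, by omega, by omega⟩
  · refine key (t + (5 * q + 1 : ℕ)) (hnot _ (q - 1) 6 (by omega) (by simp)
      (by rw [show 5 * q + 1 = 5 * (q - 1) + 6 by omega])) (Or.inr rfl) (Or.inl ?_)
      (Or.inl ?_) (Or.inl ?_)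
    · exact hs' _ (5 * q + 2) (by simpa using e (5 * q + 1) 1 (5 * q + 2) (by omega))
        ⟨q - 1, by omega, by omega⟩
    · exact hs' _ (5 * q + 4) (by simpa using e (5 * q + 1) 3 (5 * q + 4) (by omega))
        ⟨0, by omega, by omega⟩
    · exact hs' _ (5 * q + 8) (by simpa using e (5 * q + 1) 7 (5 * q + 8) (by omega))
        ⟨1, by omega, by omega⟩
  · refine key (t + (5 * k + 1 : ℕ)) (hnot _ k 1 (by omega) (by simp) rfl) (Or.inl ?_) (Or.inl ?_)
      (Or.inr ?_) (Or.inl ?_)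
    · exact hs' _ _ rfl ⟨k, by omega, by omega⟩
    · exact hs' _ (5 * k + 2) (by simpa using e (5 * k + 1) 1 (5 * k + 2) (by omega))
        ⟨k - 1, by omega, by omega⟩
    · simpa using e (5 * k + 1) 3 (5 * k + 4) (by omega)
    · rcases (by omega : k + 1 = q ∨ k + 1 < q) with h | h
      · exact hs' _ (5 * k + 8) (by simpa using e (5 * k + 1) 7 (5 * k + 8) (by omega))
          ⟨0, by omega, by omega⟩
      · exact hs' _ (5 * k + 8) (by simpa using e (5 * k + 1) 7 (5 * k + 8) (by omega))
          ⟨k + 1, by omega, by omega⟩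

end NoOverlap

/-! ### Covers, punctured covers and symmetries. -/

section Covers

variable {m : ℕ}

/-- Domination of a vertex by the left vertices `A` and the right vertices `B`. -/
def Dominated (A B : Finset (ZMod m)) : ZMod m ⊕ ZMod m → Prop
  | Sum.inl x => LeftDominated A B x
  | Sum.inr x => RightDominated A B x

/-- Some set of at most `k` vertices dominates all vertices. -/
def HasCover (m k : ℕ) : Prop :=
  ∃ A B : Finset (ZMod m), A.card + B.card ≤ k ∧ ∀ w, Dominated A B w

/-- Some set of at most `k` vertices other than `u` dominates all vertices other than `u`. -/
def HasPuncturedCover (m k : ℕ) (u : ZMod m ⊕ ZMod m) : Prop :=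
  ∃ A B : Finset (ZMod m), A.card + B.card ≤ k ∧ u ∉ A.disjSum B ∧ ∀ w, w ≠ u → Dominated A B w

/-- The translate of a set of vertices. -/
def shiftBy (t : ZMod m) (A : Finset (ZMod m)) : Finset (ZMod m) :=
  A.map (addRightEmbedding t)

theorem mem_shiftBy {t x : ZMod m} {A : Finset (ZMod m)} : x ∈ shiftBy t A ↔ x - t ∈ A := by
  simp only [shiftBy, Finset.mem_map, addRightEmbedding_apply]
  constructor
  · rintro ⟨a, ha, rfl⟩
    simpa using ha
  · exact fun h => ⟨_, h, by simp⟩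

theorem card_shiftBy (t : ZMod m) (A : Finset (ZMod m)) : (shiftBy t A).card = A.card :=
  Finset.card_map _

theorem leftDominated_shiftBy {t x : ZMod m} {A B : Finset (ZMod m)} :
    LeftDominated (shiftBy t A) (shiftBy t B) x ↔ LeftDominated A B (x - t) := by
  simp only [LeftDominated, mem_shiftBy, add_sub_right_comm]

theorem mem_spread_shiftBy {t x : ZMod m} {A : Finset (ZMod m)} :
    x ∈ spread (shiftBy t A) ↔ x - t ∈ spread A := by
  simp only [mem_spread, mem_shiftBy, sub_right_comm _ t]

theorem rightDominated_shiftBy {t x : ZMod m} {A B : Finset (ZMod m)} :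
    RightDominated (shiftBy t A) (shiftBy t B) x ↔ RightDominated A B (x - t) := by
  simp only [RightDominated, mem_shiftBy, mem_spread_shiftBy]

theorem HasPuncturedCover.shiftBy_left {k : ℕ} {z : ZMod m}
    (h : HasPuncturedCover m k (Sum.inl z)) (t : ZMod m) :
    HasPuncturedCover m k (Sum.inl (z + t)) := by
  obtain ⟨A, B, hk, hu, h⟩ := h
  refine ⟨shiftBy t A, shiftBy t B, by simpa only [card_shiftBy] using hk,
    by simpa [mem_shiftBy] using hu, ?_⟩
  rintro (x | x) hx
  · exact leftDominated_shiftBy.2 (h (Sum.inl _) (by simpa [sub_eq_iff_eq_add] using hx))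
  · exact rightDominated_shiftBy.2 (h (Sum.inr _) (by simp))

theorem HasPuncturedCover.reflect_left {k : ℕ} {z : ZMod m}
    (h : HasPuncturedCover m k (Sum.inl z)) : HasPuncturedCover m k (Sum.inr (-z)) := by
  obtain ⟨A, B, hk, hu, h⟩ := h
  refine ⟨reflect B, reflect A, by simpa only [card_reflect, add_comm] using hk,
    by simpa [mem_reflect] using hu, ?_⟩
  rintro (x | x) hx
  · exact leftDominated_reflect.2 (h (Sum.inr _) (by simp))
  · exact rightDominated_reflect.2 (h (Sum.inl _) (by simpa [neg_eq_iff_eq_neg] using hx))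

theorem HasPuncturedCover.reflect_right {k : ℕ} {z : ZMod m}
    (h : HasPuncturedCover m k (Sum.inr z)) : HasPuncturedCover m k (Sum.inl (-z)) := by
  obtain ⟨A, B, hk, hu, h⟩ := h
  refine ⟨reflect B, reflect A, by simpa only [card_reflect, add_comm] using hk,
    by simpa [mem_reflect] using hu, ?_⟩
  rintro (x | x) hx
  · exact leftDominated_reflect.2 (h (Sum.inr _) (by simpa [neg_eq_iff_eq_neg] using hx))
  · exact rightDominated_reflect.2 (h (Sum.inl _) (by simp))

/-- The automorphisms of the Knödel graph are transitive on the vertices. -/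
theorem HasPuncturedCover.all {k : ℕ} {u : ZMod m ⊕ ZMod m} (h : HasPuncturedCover m k u)
    (v : ZMod m ⊕ ZMod m) : HasPuncturedCover m k v := by
  have key : ∀ z w, HasPuncturedCover m k (Sum.inl z) → HasPuncturedCover m k (Sum.inl w) := by
    intro z w hz
    simpa using hz.shiftBy_left (w - z)
  have h0 : HasPuncturedCover m k (Sum.inl 0) := by
    rcases u with z | z
    · exact key _ _ h
    · exact key _ _ h.reflect_right
  rcases v with w | w
  · exact key _ _ h0
  · simpa using (key 0 (-w) h0).reflect_left

end Covers

/-! ### Domination numbers in terms of covers. -/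

section Graph

variable {V : Type*}

theorem dominationNumber_le {G : SimpleGraph V} {D : Finset V} (hD : IsDominatingSet G D) :
    dominationNumber G ≤ D.card :=
  Nat.sInf_le ⟨D, hD, rfl⟩

theorem exists_card_eq_dominationNumber [Fintype V] (G : SimpleGraph V) :
    ∃ D : Finset V, IsDominatingSet G D ∧ D.card = dominationNumber G :=
  Nat.sInf_mem (s := {k : ℕ | ∃ D : Finset V, IsDominatingSet G D ∧ D.card = k})
    ⟨_, Finset.univ, fun u hu => absurd (Finset.mem_univ u) hu, rfl⟩

theorem dominationNumber_deleteVertex_le {G : SimpleGraph V} {u : V} {D : Finset V} (hu : u ∉ D)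
    (hD : ∀ w, w ≠ u → w ∉ D → ∃ v ∈ D, G.Adj w v) :
    dominationNumber (deleteVertex G u) ≤ D.card := by
  classical
  have hdom : IsDominatingSet (deleteVertex G u) (D.subtype fun w => w ≠ u) := by
    rintro ⟨w, hw⟩ hwD
    obtain ⟨v, hv, hwv⟩ := hD w hw (by simpa using hwD)
    exact ⟨⟨v, fun h => hu (h ▸ hv)⟩, by simpa using hv, hwv⟩
  refine (dominationNumber_le hdom).trans ?_
  rw [Finset.card_subtype]
  exact Finset.card_filter_le _ _

theorem exists_card_eq_dominationNumber_deleteVertex [Fintype V] [DecidableEq V]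
    (G : SimpleGraph V) (u : V) :
    ∃ D : Finset V, u ∉ D ∧ (∀ w, w ≠ u → w ∉ D → ∃ v ∈ D, G.Adj w v) ∧
      D.card = dominationNumber (deleteVertex G u) := by
  obtain ⟨D, hD, hcard⟩ := exists_card_eq_dominationNumber (deleteVertex G u)
  refine ⟨D.map (Function.Embedding.subtype _), by simp, fun w hw hwD => ?_, by simpa using hcard⟩
  obtain ⟨v, hv, hwv⟩ := hD ⟨w, hw⟩ fun h => hwD (by simpa using ⟨hw, h⟩)
  exact ⟨v, by simpa using ⟨v.2, hv⟩, hwv⟩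

variable {n : ℕ}

theorem knodelGraph_four_adj {i j : ZMod (n / 2)} :
    (∃ k < 4, j = i + (2 ^ k - 1)) ↔ j = i ∨ j = i + 1 ∨ j = i + 3 ∨ j = i + 7 := by
  simp only [Nat.exists_lt_succ_left, Nat.not_lt_zero, false_and, exists_false, or_false]
  norm_num

theorem dominated_iff {A B : Finset (ZMod (n / 2))} {u : ZMod (n / 2) ⊕ ZMod (n / 2)} :
    Dominated A B u ↔ (u ∉ A.disjSum B → ∃ v ∈ A.disjSum B, (knodelGraph 4 n).Adj u v) := by
  rcases u with x | x
  · have hadj : ∀ j, (knodelGraph 4 n).Adj (Sum.inl x) (Sum.inr j) ↔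
        j = x ∨ j = x + 1 ∨ j = x + 3 ∨ j = x + 7 := fun j => knodelGraph_four_adj
    have hadj' : ∀ j, ¬ (knodelGraph 4 n).Adj (Sum.inl x) (Sum.inl j) := fun j h => h
    simp only [Dominated, LeftDominated, Finset.inl_mem_disjSum, Sum.exists, Finset.inr_mem_disjSum,
      hadj, hadj', and_false, exists_false, false_or, and_or_left, exists_or, exists_eq_right]
    tauto
  · have hadj : ∀ i, (knodelGraph 4 n).Adj (Sum.inr x) (Sum.inl i) ↔
        i = x ∨ i = x - 1 ∨ i = x - 3 ∨ i = x - 7 := fun i =>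
      knodelGraph_four_adj.trans (by simp only [eq_sub_iff_add_eq, eq_comm])
    have hadj' : ∀ j, ¬ (knodelGraph 4 n).Adj (Sum.inr x) (Sum.inr j) := fun j h => h
    simp only [Dominated, RightDominated, mem_spread, Finset.inl_mem_disjSum, Sum.exists,
      Finset.inr_mem_disjSum, hadj, hadj', and_false, exists_false, or_false, and_or_left,
      exists_or, exists_eq_right]
    tauto

theorem hasCover_iff (hn : n / 2 ≠ 0) {k : ℕ} :
    HasCover (n / 2) k ↔ dominationNumber (knodelGraph 4 n) ≤ k := by
  have : NeZero (n / 2) := ⟨hn⟩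
  constructor
  · rintro ⟨A, B, hk, h⟩
    refine (dominationNumber_le (D := A.disjSum B) fun u => dominated_iff.1 (h u)).trans ?_
    rwa [Finset.card_disjSum]
  · intro h
    obtain ⟨D, hD, hcard⟩ := exists_card_eq_dominationNumber (knodelGraph 4 n)
    rw [← D.toLeft_disjSum_toRight] at hD hcard
    rw [Finset.card_disjSum] at hcard
    exact ⟨D.toLeft, D.toRight, by omega, fun w => dominated_iff.2 (hD w)⟩

theorem hasPuncturedCover_iff (hn : n / 2 ≠ 0) {k : ℕ} {u : ZMod (n / 2) ⊕ ZMod (n / 2)} :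
    HasPuncturedCover (n / 2) k u ↔
      dominationNumber (deleteVertex (knodelGraph 4 n) u) ≤ k := by
  have : NeZero (n / 2) := ⟨hn⟩
  constructor
  · rintro ⟨A, B, hk, hu, h⟩
    refine (dominationNumber_deleteVertex_le hu fun w hw => dominated_iff.1 (h w hw)).trans ?_
    rwa [Finset.card_disjSum]
  · intro h
    obtain ⟨D, hu, hD, hcard⟩ := exists_card_eq_dominationNumber_deleteVertex (knodelGraph 4 n) u
    rw [← D.toLeft_disjSum_toRight] at hD hcard hu
    rw [Finset.card_disjSum] at hcard
    exact ⟨D.toLeft, D.toRight, by omega, hu, fun w hw => dominated_iff.2 (hD w hw)⟩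

theorem isDominationCritical_of_covers (hn : n / 2 ≠ 0) {k : ℕ} {u : ZMod (n / 2) ⊕ ZMod (n / 2)}
    (hk : ¬ HasCover (n / 2) k) (hu : HasPuncturedCover (n / 2) k u) :
    IsDominationCritical (knodelGraph 4 n) := by
  intro v
  rw [hasCover_iff hn] at hk
  have := (hasPuncturedCover_iff hn).1 (hu.all v)
  omega

/-- The hypotheses give γ(G) ≤ k + 1 ≤ γ(G - u), so no deletion lowers the domination number. -/
theorem not_isDominationCritical_of_covers (hn : n / 2 ≠ 0) {k : ℕ}
    (hk : HasCover (n / 2) (k + 1)) (hu : ∀ u, ¬ HasPuncturedCover (n / 2) k u) :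
    ¬ IsDominationCritical (knodelGraph 4 n) := by
  intro h
  rw [hasCover_iff hn] at hk
  have := h (Sum.inl 0)
  exact hu (Sum.inl 0) ((hasPuncturedCover_iff hn).2 (by omega))

end Graph

/-! ### Lower bounds for covers, by residue of m modulo 5. -/

section CoverLowerBounds

variable {m : ℕ}

theorem HasPuncturedCover.exists_holes {k : ℕ} {u : ZMod m ⊕ ZMod m}
    (h : HasPuncturedCover m k u) : ∃ A B HL HR : Finset (ZMod m), A.card + B.card ≤ k ∧
      HL.card + HR.card = 1 ∧ (∀ x, x ∉ HL → LeftDominated A B x) ∧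
      ∀ x, x ∉ HR → RightDominated A B x := by
  obtain ⟨A, B, hk, -, h⟩ := h
  rcases u with z | z
  · exact ⟨A, B, {z}, ∅, hk, by simp, fun x hx => h (Sum.inl x) (by simpa using hx),
      fun x _ => h (Sum.inr x) (by simp)⟩
  · exact ⟨A, B, ∅, {z}, hk, by simp, fun x _ => h (Sum.inl x) (by simp),
      fun x hx => h (Sum.inr x) (by simpa using hx)⟩

/-- Up to a reflection only a left vertex is left undominated. -/
theorem HasPuncturedCover.exists_left {k : ℕ} {u : ZMod m ⊕ ZMod m}
    (h : HasPuncturedCover m k u) : ∃ A B : Finset (ZMod m), A.card + B.card ≤ k ∧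
      (∀ x, RightDominated A B x) ∧ ∀ x, x ≠ 0 → LeftDominated A B x := by
  obtain ⟨A, B, hk, -, h⟩ := h.all (Sum.inl 0)
  exact ⟨A, B, hk, fun x => h (Sum.inr x) (by simp), fun x hx => h (Sum.inl x) (by simpa using hx)⟩

theorem card_lt_of_right_holes [NeZero m] {q : ℕ} (hq : 2 ≤ q) (hm : m = 5 * q + 1 ∨ m = 5 * q + 2)
    {A B H : Finset (ZMod m)} (hH : H.card + (5 * q + 1) ≤ m) (hB : B.card ≤ q + 1)
    (h : ∀ x, x ∉ H → RightDominated A B x) : A.card ≠ q := by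
  intro hA
  have h1 := card_inter_spread_add_le h
  have h2 := card_spread_lt_of_period hq hm hA
  omega

/-- The bound on the holes treats m = 5q + 1 without a hole and m = 5q + 2 with one hole at once.
Counting gives both sides at least q vertices, so one side has exactly q and would be a packing
without overlap. -/
theorem card_lt_of_holes [NeZero m] {q : ℕ} (hq : 2 ≤ q) (hm : m = 5 * q + 1 ∨ m = 5 * q + 2)
    {A B HL HR : Finset (ZMod m)} (hH : HL.card + HR.card + (5 * q + 1) ≤ m)
    (hL : ∀ x, x ∉ HL → LeftDominated A B x) (hR : ∀ x, x ∉ HR → RightDominated A B x) :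
    2 * q + 1 < A.card + B.card := by
  by_contra! hk
  have h1 := card_add_le_of_left hL
  have h2 := card_add_le_of_right hR
  by_cases hA : A.card = q
  · exact card_lt_of_right_holes hq hm (by omega) (by omega) hR hA
  · refine card_lt_of_right_holes (A := reflect B) (B := reflect A) (H := reflect HL) hq hm
      (by rw [card_reflect]; omega) (by rw [card_reflect]; omega) (fun x hx => ?_)
      (by rw [card_reflect]; omega)
    exact rightDominated_reflect.2 (hL _ (by rwa [mem_reflect] at hx))

theorem not_hasCover_one [NeZero m] {q : ℕ} (hq : 2 ≤ q) (hm : m = 5 * q + 1) :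
    ¬ HasCover m (2 * q + 1) := by
  rintro ⟨A, B, hk, h⟩
  have := card_lt_of_holes hq (Or.inl hm) (HL := ∅) (HR := ∅) (by simp [hm])
    (fun x _ => h (Sum.inl x)) (fun x _ => h (Sum.inr x))
  omega

theorem not_hasPuncturedCover_two [NeZero m] {q : ℕ} (hq : 2 ≤ q) (hm : m = 5 * q + 2)
    (u : ZMod m ⊕ ZMod m) : ¬ HasPuncturedCover m (2 * q + 1) u := by
  intro h
  obtain ⟨A, B, HL, HR, hk, hH, hL, hR⟩ := h.exists_holes
  have := card_lt_of_holes hq (Or.inr hm) (by omega) hL hR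
  omega

theorem not_hasCover_four [NeZero m] {q : ℕ} (hq : 3 ≤ q) (hm : m = 5 * q + 4) :
    ¬ HasCover m (2 * q + 3) := by
  rintro ⟨A, B, hk, h⟩
  have hL : ∀ x, LeftDominated A B x := fun x => h (Sum.inl x)
  have hR : ∀ x, RightDominated A B x := fun x => h (Sum.inr x)
  have h1 := card_add_le_of_left (H := ∅) fun x _ => hL x
  have h2 := card_add_le_of_right (H := ∅) fun x _ => hR x
  rw [Finset.card_empty] at h1 h2
  by_cases hA : A.card = q + 1
  · exact not_dominated_four hm hq hA (by omega) hR hL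
  · exact not_dominated_four hm hq (A := reflect B) (B := reflect A) (by rw [card_reflect]; omega)
      (by rw [card_reflect]; omega) (fun x => rightDominated_reflect.2 (hL _))
      (fun x => leftDominated_reflect.2 (hR _))

theorem not_hasPuncturedCover_three [NeZero m] {q : ℕ} (hq : 4 ≤ q) (hm : m = 5 * q + 3)
    (u : ZMod m ⊕ ZMod m) : ¬ HasPuncturedCover m (2 * q + 2) u := by
  intro h
  obtain ⟨A, B, hk, hR, hL⟩ := h.exists_left
  have h1 := card_add_le_of_left (H := {0}) fun x hx => hL x (by simpa using hx)
  have h2 := card_add_le_of_right (H := ∅) fun x _ => hR x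
  rw [Finset.card_empty] at h2
  rw [Finset.card_singleton] at h1
  by_cases hA : A.card = q + 1
  · exact not_dominated_three hm hq hA (by omega) hR 0 hL
  · exact not_dominated_three_of_card_eq hm (by omega) (A := reflect B) (B := reflect A)
      (by rw [card_reflect]; omega) (by rw [card_reflect]; omega) 0
      (fun x hx => rightDominated_reflect.2 (hL _ (by simpa using hx)))
      (fun x => leftDominated_reflect.2 (hR _))

theorem not_hasPuncturedCover_fourteen (u : ZMod 14 ⊕ ZMod 14) : ¬ HasPuncturedCover 14 6 u := by
  intro h
  obtain ⟨A, B, hk, hR, hL⟩ := h.exists_left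
  have h1 := card_add_le_of_left (H := {0}) fun x hx => hL x (by simpa using hx)
  have h2 := card_add_le_of_right (H := ∅) fun x _ => hR x
  rw [Finset.card_empty] at h2
  rw [Finset.card_singleton] at h1
  exact not_dominated_fourteen (by omega) (by omega) hR 0 hL

/-- For odd k one side has at most (k - 1)/2 vertices, which is too few for the opposite side by
counting alone. -/
theorem not_hasPuncturedCover_of_card [NeZero m] {k : ℕ} (hk : 2 * (k / 2) + 1 = k)
    (hkm : 5 * k + 1 ≤ 2 * m) (u : ZMod m ⊕ ZMod m) : ¬ HasPuncturedCover m k u := by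
  intro h
  obtain ⟨A, B, HL, HR, hk, hH, hL, hR⟩ := h.exists_holes
  have h1 := card_add_le_of_left hL
  have h2 := card_add_le_of_right hR
  omega

set_option synthInstance.maxSize 1000 in
/-- Three translates of `{0, 1, 3, 7}` covering at least ten elements of a cycle of length `13` cover
at most eleven, and at least one left vertex stays undominated when the remaining right vertices
and one more right vertex are added. -/
theorem spread_thirteen : ∀ b c y : ZMod 13, ({0, b, c} : Finset (ZMod 13)).card = 3 →
    10 ≤ (spread {0, b, c}).card → (spread {0, b, c}).card ≤ 11 ∧
      ∃ x, x ∉ ({0, b, c} : Finset (ZMod 13)) ∧ x ∈ spread {0, b, c} ∧ x + 1 ∈ spread {0, b, c} ∧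
        x + 3 ∈ spread {0, b, c} ∧ x + 7 ∈ spread {0, b, c} ∧
        ((spread {0, b, c}).card = 10 ∨ (y ≠ x ∧ y ≠ x + 1 ∧ y ≠ x + 3 ∧ y ≠ x + 7)) := by
  decide +kernel

theorem not_hasCover_thirteen : ¬ HasCover 13 6 := by
  rintro ⟨A, B, hk, h⟩
  have hL : ∀ x, LeftDominated A B x := fun x => h (Sum.inl x)
  have hR : ∀ x, RightDominated A B x := fun x => h (Sum.inr x)
  have h1 := card_add_le_of_left (H := ∅) fun x _ => hL x
  have h2 := card_add_le_of_right (H := ∅) fun x _ => hR x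
  rw [Finset.card_empty] at h1 h2
  -- Counting gives |A| = |B| = 3; a translation puts 0 into A and leaves a small finite check.
  obtain ⟨t, b, c, hbc⟩ : ∃ t b c, shiftBy t A = {0, b, c} := by
    obtain ⟨x, y, z, -, -, -, rfl⟩ := Finset.card_eq_three.1 (show A.card = 3 by omega)
    exact ⟨-x, y + -x, z + -x, by simp [shiftBy]⟩
  have hcard := card_shiftBy t A
  have hR' : ∀ x, RightDominated {0, b, c} (shiftBy t B) x := fun x =>
    hbc ▸ rightDominated_shiftBy.2 (hR _)
  have hL' : ∀ x, LeftDominated {0, b, c} (shiftBy t B) x := fun x =>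
    hbc ▸ leftDominated_shiftBy.2 (hL _)
  have h3 := card_inter_spread_add_le (H := ∅) fun x _ => hR' x
  rw [card_shiftBy, Finset.card_empty] at h3
  rw [hbc] at hcard
  -- The value 0 for y is arbitrary: only the bound 11 is used here. It leaves at most one element
  -- of B in the spread, and that element is the y of the second application.
  obtain ⟨h4, -⟩ := spread_thirteen b c 0 (by omega) (by omega)
  obtain ⟨y, hy⟩ : ∃ y, ∀ z ∈ shiftBy t B ∩ spread {0, b, c}, z = y := by
    rcases (shiftBy t B ∩ spread {0, b, c}).eq_empty_or_nonempty with h | ⟨y, hy⟩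
    · exact ⟨0, by simp [h]⟩
    · exact ⟨y, fun z hz => Finset.card_le_one.1 (by omega) _ hz _ hy⟩
  obtain ⟨-, x, hx, hx0, hx1, hx3, hx7, hxy⟩ := spread_thirteen b c y (by omega) (by omega)
  have key : ∀ z, z ∈ shiftBy t B → z ∈ spread {0, b, c} → z = y ∧
      (spread ({0, b, c} : Finset (ZMod 13))).card ≠ 10 := by
    intro z hz hz'
    have hmem := Finset.mem_inter.2 ⟨hz, hz'⟩
    have := Finset.card_pos.2 ⟨z, hmem⟩
    exact ⟨hy z hmem, by omega⟩
  rcases hL' x with h | h | h | h | h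
  · exact hx h
  · exact hxy.elim (key _ h hx0).2 fun h' => h'.1 (key _ h hx0).1.symm
  · exact hxy.elim (key _ h hx1).2 fun h' => h'.2.1 (key _ h hx1).1.symm
  · exact hxy.elim (key _ h hx3).2 fun h' => h'.2.2.1 (key _ h hx3).1.symm
  · exact hxy.elim (key _ h hx7).2 fun h' => h'.2.2.2 (key _ h hx7).1.symm

end CoverLowerBounds

/-! ### Explicit covers. -/

section Constructions

variable {m : ℕ}

/-- The residues of `c, c + 5, …, c + 5 * (k - 1)`. -/
def progression (m c k : ℕ) : Finset (ZMod m) :=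
  (Finset.range k).image fun i => ((c + 5 * i : ℕ) : ZMod m)

theorem card_progression_le (c k : ℕ) : (progression m c k).card ≤ k :=
  Finset.card_image_le.trans (Finset.card_range k).le

theorem mem_progression {c k a : ℕ} (h : a % 5 = c % 5 ∧ c ≤ a ∧ a < c + 5 * k) :
    (a : ZMod m) ∈ progression m c k :=
  Finset.mem_image.2 ⟨(a - c) / 5, Finset.mem_range.2 (by omega), by congr 1; omega⟩

theorem notMem_progression {c k a : ℕ} (ham : a < m) (h : a < c ∨ a % 5 ≠ c % 5)
    (hk : c + 5 * k < m + 5) : (a : ZMod m) ∉ progression m c k := by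
  intro hmem
  obtain ⟨i, hi, hia⟩ := Finset.mem_image.1 hmem
  rw [Finset.mem_range] at hi
  have := (ZMod.natCast_eq_natCast_iff' _ _ _).1 hia
  rw [Nat.mod_eq_of_lt (by omega), Nat.mod_eq_of_lt ham] at this
  omega

/-- Sets of natural numbers containing representatives of `A` and `B` suffice to check domination. -/
theorem dominated_of_nat [NeZero m] {A B : Finset (ZMod m)} (P Q : ℕ → Prop)
    (hP : ∀ a, P a → (a : ZMod m) ∈ A) (hQ : ∀ b, Q b → (b : ZMod m) ∈ B) (R S : ℕ → Prop)
    (hR : ∀ x, x < m → R x → P x ∨ Q x ∨ Q (x + 1) ∨ Q (x + 3) ∨ Q (x + 7) ∨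
      (m ≤ x + 1 ∧ Q (x + 1 - m)) ∨ (m ≤ x + 3 ∧ Q (x + 3 - m)) ∨ (m ≤ x + 7 ∧ Q (x + 7 - m)))
    (hS : ∀ x, x < m → S x → Q x ∨ P x ∨ (1 ≤ x ∧ P (x - 1)) ∨ (3 ≤ x ∧ P (x - 3)) ∨
      (7 ≤ x ∧ P (x - 7)) ∨ P (x + m - 1) ∨ P (x + m - 3) ∨ P (x + m - 7)) (hm : 7 ≤ m)
    {w : ZMod m ⊕ ZMod m} (hw : w.elim (fun x => R x.val) (fun x => S x.val)) :
    Dominated A B w := by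
  have hm0 : (m : ZMod m) = 0 := ZMod.natCast_self m
  rcases w with x | x <;> obtain ⟨n, hn, rfl⟩ : ∃ n : ℕ, n < m ∧ (n : ZMod m) = x :=
    ⟨x.val, ZMod.val_lt x, ZMod.natCast_zmod_val x⟩
  · simp only [Sum.elim_inl, ZMod.val_natCast_of_lt hn] at hw
    have hsub : ∀ s, m ≤ n + s → ((n + s - m : ℕ) : ZMod m) = n + s := fun s h => by
      rw [Nat.cast_sub h, hm0]; push_cast; ring
    rcases hR n hn hw with h | h | h | h | h | ⟨h', h⟩ | ⟨h', h⟩ | ⟨h', h⟩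
    · exact Or.inl (hP _ h)
    · exact Or.inr (Or.inl (hQ _ h))
    · exact Or.inr (Or.inr (Or.inl (by simpa using hQ _ h)))
    · exact Or.inr (Or.inr (Or.inr (Or.inl (by simpa using hQ _ h))))
    · exact Or.inr (Or.inr (Or.inr (Or.inr (by simpa using hQ _ h))))
    · exact Or.inr (Or.inr (Or.inl (by simpa [hsub _ h'] using hQ _ h)))
    · exact Or.inr (Or.inr (Or.inr (Or.inl (by simpa [hsub _ h'] using hQ _ h))))
    · exact Or.inr (Or.inr (Or.inr (Or.inr (by simpa [hsub _ h'] using hQ _ h))))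
  · simp only [Sum.elim_inr, ZMod.val_natCast_of_lt hn] at hw
    have hsub : ∀ s, s ≤ m → ((n + m - s : ℕ) : ZMod m) = n - s := fun s h => by
      rw [Nat.cast_sub (by omega)]; push_cast; rw [hm0]; ring
    simp only [Dominated, RightDominated, mem_spread]
    rcases hS n hn hw with h | h | ⟨h', h⟩ | ⟨h', h⟩ | ⟨h', h⟩ | h | h | h
    · exact Or.inl (hQ _ h)
    · exact Or.inr (Or.inl (hP _ h))
    · exact Or.inr (Or.inr (Or.inl (by simpa [h'] using hP _ h)))
    · exact Or.inr (Or.inr (Or.inr (Or.inl (by simpa [h'] using hP _ h))))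
    · exact Or.inr (Or.inr (Or.inr (Or.inr (by simpa [h'] using hP _ h))))
    · exact Or.inr (Or.inr (Or.inl (by simpa [hsub 1 (by omega)] using hP _ h)))
    · exact Or.inr (Or.inr (Or.inr (Or.inl (by simpa [hsub 3 (by omega)] using hP _ h))))
    · exact Or.inr (Or.inr (Or.inr (Or.inr (by simpa [hsub 7 (by omega)] using hP _ h))))

/-- Away from the ends the residue modulo 5 decides which neighbour dominates x; near the ends x or
m - x is explicit. In each case a single disjunct of `dominated_of_nat` can be found by `omega`. -/
theorem end_or_residue {x : ℕ} (hx : x < m) :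
    ((x = 0 ∨ x = 1 ∨ x = 2 ∨ x = 3) ∨ x = 4 ∨ x = 5 ∨ x = 6) ∨
      ((m = x + 1 ∨ m = x + 2 ∨ m = x + 3 ∨ m = x + 4) ∨ m = x + 5 ∨ m = x + 6 ∨ m = x + 7) ∨
        7 ≤ x ∧ x + 7 < m ∧ (x % 5 = 0 ∨ x % 5 = 1 ∨ x % 5 = 2 ∨ x % 5 = 3 ∨ x % 5 = 4) := by
  omega

/-- The left class 0 modulo 5 reaches the right classes 0, 1, 2, 3, and the right class 4 reaches
the left classes 1, 2, 3, 4. The later constructions repair this pattern where the cycle closes. -/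
theorem hasCover_zero {q : ℕ} (hq : 2 ≤ q) (hm : m = 5 * q) : HasCover m (2 * q) := by
  have : NeZero m := ⟨by omega⟩
  have h1 := card_progression_le (m := m) 0 q
  have h2 := card_progression_le (m := m) 4 q
  refine ⟨progression m 0 q, progression m 4 q, by omega, fun w =>
    dominated_of_nat _ _ (fun a => mem_progression) (fun b => mem_progression)
      (fun _ => True) (fun _ => True) ?_ ?_ (by omega) (by cases w <;> simp)⟩ <;>
  · intro x hx _
    rcases end_or_residue hx with ((h | h | h | h) | h | h | h) |
      ((h | h | h | h) | h | h | h) | ⟨h7, hx7, h | h | h | h | h⟩ <;>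
    (repeat first | (left; omega) | right) <;> omega

/-- The pattern misses the right vertices 2 and 5q and the left vertices 5q - 3 and 5q; adding the
right vertex 5q leaves only the deleted vertex 2. -/
theorem hasPuncturedCover_one {q : ℕ} (hq : 2 ≤ q) (hm : m = 5 * q + 1) :
    HasPuncturedCover m (2 * q + 1) (Sum.inr ((2 : ℕ) : ZMod m)) := by
  have : NeZero m := ⟨by omega⟩
  have h1 := card_progression_le (m := m) 0 q
  have h2 := card_progression_le (m := m) 4 q
  have h3 := Finset.card_insert_le ((5 * q : ℕ) : ZMod m) (progression m 4 q)
  refine ⟨progression m 0 q, insert ((5 * q : ℕ) : ZMod m) (progression m 4 q), by omega, ?_,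
    fun w hw => dominated_of_nat _ (fun b => b = 5 * q ∨ (b % 5 = 4 % 5 ∧ 4 ≤ b ∧ b < 4 + 5 * q))
      (fun a => mem_progression) ?_ (fun _ => True) (fun x => x ≠ 2) ?_ ?_ (by omega) ?_⟩
  · rw [Finset.inr_mem_disjSum, Finset.mem_insert, not_or]
    refine ⟨fun h => ?_, notMem_progression (by omega) (by omega) (by omega)⟩
    have := (ZMod.natCast_eq_natCast_iff' _ _ _).1 h
    rw [Nat.mod_eq_of_lt (by omega), Nat.mod_eq_of_lt (by omega)] at this
    omega
  · rintro b (rfl | h)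
    · exact Finset.mem_insert_self _ _
    · exact Finset.mem_insert_of_mem (mem_progression h)
  · intro x hx _
    rcases end_or_residue hx with ((h | h | h | h) | h | h | h) |
      ((h | h | h | h) | h | h | h) | ⟨h7, hx7, h | h | h | h | h⟩ <;>
    repeat first | (left; omega) | right
  · intro x hx _
    rcases end_or_residue hx with ((h | h | h | h) | h | h | h) |
      ((h | h | h | h) | h | h | h) | ⟨h7, hx7, h | h | h | h | h⟩ <;>
    repeat first | (left; omega) | right
  · rcases w with x | x
    · trivial
    · exact fun h => hw (by rw [← h, ZMod.natCast_zmod_val])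

/-- With q + 1 left vertices the pattern misses the right vertex 2 and the left vertices 5q - 3 and
5q + 1, both adjacent to it. -/
theorem hasCover_two {q : ℕ} (hq : 2 ≤ q) (hm : m = 5 * q + 2) : HasCover m (2 * q + 2) := by
  have : NeZero m := ⟨by omega⟩
  have h1 := card_progression_le (m := m) 0 (q + 1)
  have h2 := card_progression_le (m := m) 4 q
  have h3 := Finset.card_insert_le ((2 : ℕ) : ZMod m) (progression m 4 q)
  refine ⟨progression m 0 (q + 1), insert ((2 : ℕ) : ZMod m) (progression m 4 q), by omega,
    fun w => dominated_of_nat _ (fun b => b = 2 ∨ (b % 5 = 4 % 5 ∧ 4 ≤ b ∧ b < 4 + 5 * q))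
      (fun a => mem_progression) ?_ (fun _ => True) (fun _ => True) ?_ ?_ (by omega)
      (by cases w <;> simp)⟩
  · rintro b (rfl | h)
    · exact Finset.mem_insert_self _ _
    · exact Finset.mem_insert_of_mem (mem_progression h)
  all_goals
    intro x hx _
    rcases end_or_residue hx with ((h | h | h | h) | h | h | h) |
      ((h | h | h | h) | h | h | h) | ⟨h7, hx7, h | h | h | h | h⟩ <;>
    (repeat first | (left; omega) | right) <;> omega

theorem hasCover_three {q : ℕ} (hq : 2 ≤ q) (hm : m = 5 * q + 3) : HasCover m (2 * q + 3) := by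
  have : NeZero m := ⟨by omega⟩
  have h1 := card_progression_le (m := m) 2 q
  have h2 := card_progression_le (m := m) 6 q
  have h3 := Finset.card_union_le {((0 : ℕ) : ZMod m), ((1 : ℕ) : ZMod m), ((5 * q - 1 : ℕ) : ZMod m)}
    (progression m 2 q)
  have h4 := Finset.card_le_three (a := ((0 : ℕ) : ZMod m)) (b := ((1 : ℕ) : ZMod m))
    (c := ((5 * q - 1 : ℕ) : ZMod m))
  refine ⟨{((0 : ℕ) : ZMod m), ((1 : ℕ) : ZMod m), ((5 * q - 1 : ℕ) : ZMod m)} ∪ progression m 2 q,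
    progression m 6 q, by omega, fun w => dominated_of_nat
      (fun a => (a = 0 ∨ a = 1 ∨ a = 5 * q - 1) ∨ (a % 5 = 2 % 5 ∧ 2 ≤ a ∧ a < 2 + 5 * q)) _
      ?_ (fun b => mem_progression) (fun _ => True) (fun _ => True) ?_ ?_ (by omega)
      (by cases w <;> simp)⟩
  · rintro b ((rfl | rfl | rfl) | h)
    · simp
    · simp
    · simp
    · exact Finset.mem_union_right _ (mem_progression h)
  all_goals
    intro x hx _
    rcases end_or_residue hx with ((h | h | h | h) | h | h | h) |
      ((h | h | h | h) | h | h | h) | ⟨h7, hx7, h | h | h | h | h⟩ <;>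
    (repeat first | (left; omega) | right) <;> omega

theorem hasPuncturedCover_four {q : ℕ} (hq : 3 ≤ q) (hm : m = 5 * q + 4) :
    HasPuncturedCover m (2 * q + 3) (Sum.inl ((0 : ℕ) : ZMod m)) := by
  have : NeZero m := ⟨by omega⟩
  have h1 := card_progression_le (m := m) 2 (q + 1)
  have h2 := card_progression_le (m := m) 6 q
  have h3 := Finset.card_union_le {((1 : ℕ) : ZMod m), ((5 * q - 1 : ℕ) : ZMod m)}
    (progression m 2 (q + 1))
  have h4 := Finset.card_le_two (a := ((1 : ℕ) : ZMod m)) (b := ((5 * q - 1 : ℕ) : ZMod m))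
  have hne : ∀ a, 0 < a → a < m → ((0 : ℕ) : ZMod m) ≠ (a : ZMod m) := by
    intro a ha ham h
    have := (ZMod.natCast_eq_natCast_iff' _ _ _).1 h
    rw [Nat.mod_eq_of_lt (by omega), Nat.mod_eq_of_lt (by omega)] at this
    omega
  refine ⟨{((1 : ℕ) : ZMod m), ((5 * q - 1 : ℕ) : ZMod m)} ∪ progression m 2 (q + 1),
    progression m 6 q, by omega, ?_, fun w hw => dominated_of_nat
      (fun a => (a = 1 ∨ a = 5 * q - 1) ∨ (a % 5 = 2 % 5 ∧ 2 ≤ a ∧ a < 2 + 5 * (q + 1))) _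
      ?_ (fun b => mem_progression) (fun x => x ≠ 0) (fun _ => True) ?_ ?_ (by omega) ?_⟩
  · rw [Finset.inl_mem_disjSum, Finset.mem_union, Finset.mem_insert, Finset.mem_singleton, not_or,
      not_or]
    exact ⟨⟨hne _ (by omega) (by omega), hne _ (by omega) (by omega)⟩,
      notMem_progression (by omega) (by omega) (by omega)⟩
  · rintro b ((rfl | rfl) | h)
    · simp
    · simp
    · exact Finset.mem_union_right _ (mem_progression h)
  · intro x hx _
    rcases end_or_residue hx with ((h | h | h | h) | h | h | h) |
      ((h | h | h | h) | h | h | h) | ⟨h7, hx7, h | h | h | h | h⟩ <;>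
    (repeat first | (left; omega) | right) <;> omega
  · intro x hx _
    rcases end_or_residue hx with ((h | h | h | h) | h | h | h) |
      ((h | h | h | h) | h | h | h) | ⟨h7, hx7, h | h | h | h | h⟩ <;>
    (repeat first | (left; omega) | right) <;> omega
  · rcases w with x | x
    · exact fun h => hw (by rw [← h, ZMod.natCast_zmod_val])
    · trivial

theorem hasCover_eight : HasCover 8 4 :=
  ⟨{0, 1}, {5, 6}, by decide, by
    rintro (x | x) <;> revert x <;> unfold Dominated LeftDominated RightDominated <;> decide⟩

theorem hasCover_nine : HasCover 9 4 :=
  ⟨{0, 1}, {5, 6}, by decide, by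
    rintro (x | x) <;> revert x <;> unfold Dominated LeftDominated RightDominated <;> decide⟩

theorem hasCover_fourteen : HasCover 14 7 :=
  ⟨{0, 1, 2, 12}, {6, 10, 11}, by decide, by
    rintro (x | x) <;> revert x <;> unfold Dominated LeftDominated RightDominated <;> decide⟩

theorem hasCover_eighteen : HasCover 18 8 :=
  ⟨{0, 1, 9, 10}, {5, 6, 14, 15}, by decide, by
    rintro (x | x) <;> revert x <;> unfold Dominated LeftDominated RightDominated <;> decide⟩

theorem hasPuncturedCover_thirteen : HasPuncturedCover 13 6 (Sum.inl 0) :=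
  ⟨{1, 2, 6}, {10, 11, 12}, by decide, by decide, by
    rintro (x | x) <;> revert x <;> unfold Dominated LeftDominated RightDominated <;> decide⟩

end Constructions

theorem theorem4p5 (n : ℕ) (hn : 16 ≤ n) (heven : Even n) :
    IsDominationCritical (knodelGraph 4 n) ↔
      n = 26 ∨ (22 ≤ n ∧ n ≡ 2 [MOD 10]) ∨ (38 ≤ n ∧ n ≡ 8 [MOD 10]) := by
  have hn0 : n / 2 ≠ 0 := by omega
  have : NeZero (n / 2) := ⟨hn0⟩
  have hn2 : n % 2 = 0 := Nat.even_iff.1 heven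
  simp only [Nat.ModEq]
  obtain ⟨q, hq⟩ : ∃ q, q = n / 2 / 5 := ⟨_, rfl⟩
  have hm : n / 2 = 5 * q ∨ n / 2 = 5 * q + 1 ∨ n / 2 = 5 * q + 2 ∨ n / 2 = 5 * q + 3 ∨
      n / 2 = 5 * q + 4 := by omega
  rcases hm with hm | hm | hm | hm | hm
  · refine iff_of_false (not_isDominationCritical_of_covers hn0 (k := 2 * q - 1) ?_
      (not_hasPuncturedCover_of_card (by omega) (by omega))) (by omega)
    rw [show 2 * q - 1 + 1 = 2 * q by omega]
    exact hasCover_zero (by omega) hm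
  · exact iff_of_true (isDominationCritical_of_covers hn0 (not_hasCover_one (by omega) hm)
      (hasPuncturedCover_one (by omega) hm)) (by omega)
  · exact iff_of_false (not_isDominationCritical_of_covers hn0 (hasCover_two (by omega) hm)
      (not_hasPuncturedCover_two (by omega) hm)) (by omega)
  -- For q = 1 and q = 3 there are covers meeting the counting bound, with 4 and 8 vertices. For q =
  -- 2 one vertex can be saved by a deletion, which makes n = 26 exceptional.
  · rcases (by omega : n = 16 ∨ n = 26 ∨ n = 36 ∨ 4 ≤ q) with rfl | rfl | rfl | h4
    · exact iff_of_false (not_isDominationCritical_of_covers hn0 hasCover_eight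
        (not_hasPuncturedCover_of_card (by norm_num) (by norm_num))) (by omega)
    · exact iff_of_true (isDominationCritical_of_covers hn0 not_hasCover_thirteen
        hasPuncturedCover_thirteen) (by omega)
    · exact iff_of_false (not_isDominationCritical_of_covers hn0 hasCover_eighteen
        (not_hasPuncturedCover_of_card (by norm_num) (by norm_num))) (by omega)
    · exact iff_of_false (not_isDominationCritical_of_covers hn0 (hasCover_three (by omega) hm)
        (not_hasPuncturedCover_three h4 hm)) (by omega)
  -- For q = 1 and q = 2 there are covers with 4 and 7 vertices, fewer than the 2q + 4 needed from q
  -- = 3 on, and deleting a vertex does not improve them.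
  · rcases (by omega : n = 18 ∨ n = 28 ∨ 3 ≤ q) with rfl | rfl | h3
    · exact iff_of_false (not_isDominationCritical_of_covers hn0 hasCover_nine
        (not_hasPuncturedCover_of_card (by norm_num) (by norm_num))) (by omega)
    · exact iff_of_false (not_isDominationCritical_of_covers hn0 hasCover_fourteen
        not_hasPuncturedCover_fourteen) (by omega)
    · exact iff_of_true (isDominationCritical_of_covers hn0 (not_hasCover_four h3 hm)
        (hasPuncturedCover_four h3 hm)) (by omega)
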